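/- Let $n \ge 2$. For $n \ge 3$ let $\mathcal{Y}_n(\mathbb{C})$ be the set of genus one normal curves of degree $n$ in $\mathbb{P}^{n-1}(\mathbb{C})$, that is, of the smooth curves of genus one and degree $n$ that lie in no hyperplane (as Riemann surfaces: images of complex tori $\mathbb{C}/\Lambda$ under nondegenerate holomorphic embeddings of degree $n$). Let $\mathcal{Y}_2(\mathbb{C})$ be the set of double covers $\mathcal{C} \to \mathbb{P}^1(\mathbb{C})$ by curves of genus one, where a double cover is identified with the set of points of $\mathbb{P}^1(\mathbb{C})$ over which it is ramified. Let $\mathcal{Y}_n(\mathbb{R}) \subset \mathcal{Y}_n(\mathbb{C})$ be the subset of those that are defined over $\mathbb{R}$, that is, cut out by real homogeneous polynomials. Let $\mathcal{H}^+_n(\mathbb{C})$ and $\mathcal{H}^+_n(\mathbb{R})$ be the sets of positive definite Hermitian, respectively real symmetric, $n \times n$ matrices. For $K = \mathbb{R}$ or $\mathbb{C}$ the group $\operatorname{SL}_n(K)$ acts on $\mathcal{Y}_n(K)$ through linear changes of coordinates on $\mathbb{P}^{n-1}$, and on $\mathcal{H}^+_n(K)$ by $g \cdot M = \bar{g}^{-t}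 M g^{-1}$. There is a unique $\operatorname{SL}_n(\mathbb{C})$-covariant (that is, equivariant) map $$\varphi_{\mathbb{C}} : \mathcal{Y}_n(\mathbb{C}) \to \mathcal{H}^+_n(\mathbb{C})/\mathbb{R}^\times_{>0}.$$ Moreover: 1. Let $\mathcal{C} \in \mathcal{Y}_n(\mathbb{C})$ have Jacobian $E$, and let $H_n \subset \operatorname{SL}_n(\mathbb{C})$ be the Heisenberg group of $\mathcal{C}$: the group of all $h \in \operatorname{SL}_n(\mathbb{C})$ whose action on $\mathbb{P}^{n-1}(\mathbb{C})$ extends the translation of $\mathcal{C}$ by some point of $E[n]$ (for $n = 2$: is compatible, under $\mathcal{C} \to \mathbb{P}^1$, with such a translation). Then $\varphi_{\mathbb{C}}(\mathcal{C})$ is the Heisenberg-invariant inner product: a matrix $M \in \mathcal{H}^+_n(\mathbb{C})$ represents $\varphi_{\mathbb{C}}(\mathcal{C})$ if and only if $h \cdot M = M$ for all $h \in H_n$. 2. $\varphi_{\mathbb{C}}$ is compatible with complex conjugation: $\varphi_{\mathbb{C}}(\overline{\mathcal{C}}) = \overline{\varphi_{\mathbb{C}}(\mathcal{C})}$ for all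 $\mathcal{C} \in \mathcal{Y}_n(\mathbb{C})$. 3. $\varphi_{\mathbb{C}}$ restricts to an $\operatorname{SL}_n(\mathbb{R})$-covariant map $\varphi_{\mathbb{R}} : \mathcal{Y}_n(\mathbb{R}) \to \mathcal{H}^+_n(\mathbb{R})/\mathbb{R}^\times_{>0}$. -/

import Mathlib

open scoped Matrix Topology ComplexOrder LinearAlgebra.Projectivization Pointwise ComplexConjugate

noncomputable section

namespace GenusOne

/-! ### Forms up to positive scaling -/

/-- Positive definite Hermitian (for `K = ℂ`) or symmetric (for `K = ℝ`) matrices; the matrix `M`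
stands for the form `x ↦ xᴴ M x`. -/
def PosHerm (K : Type) [RCLike K] (n : ℕ) : Type :=
  {M : Matrix (Fin n) (Fin n) K // M.PosDef}

/-- Equality up to a positive real factor. -/
instance posHermSetoid (K : Type) [RCLike K] (n : ℕ) : Setoid (PosHerm K n) where
  r M N := ∃ c : ℝ, 0 < c ∧ N.1 = c • M.1
  iseqv :=
    { refl := fun M => ⟨1, one_pos, (one_smul ℝ M.1).symm⟩
      symm := by
        rintro M N ⟨c, hc, h⟩
        exact ⟨c⁻¹, inv_pos.mpr hc, by rw [h, smul_smul, inv_mul_cancel₀ hc.ne', one_smul]⟩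
      trans := by
        rintro M N P ⟨c, hc, h⟩ ⟨d, hd, h'⟩
        exact ⟨d * c, mul_pos hd hc, by rw [h', h, smul_smul]⟩ }

/-- The quotient of the positive definite matrices by the positive real scalars. -/
def HermClass (K : Type) [RCLike K] (n : ℕ) : Type := Quotient (posHermSetoid K n)

/-- The class of a positive definite matrix up to positive real scalars. -/
def PosHerm.cls {K : Type} [RCLike K] {n : ℕ} (M : PosHerm K n) : HermClass K n := ⟦M⟧

lemma posDef_smul {K : Type} [RCLike K] {n : ℕ} (g : Matrix.SpecialLinearGroup (Fin n) K)
    {M : Matrix (Fin n) (Fin n) K} (hM : M.PosDef) :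
    ((g⁻¹).1ᴴ * M * (g⁻¹).1).PosDef := by
  apply hM.conjTranspose_mul_mul_same
  apply Matrix.mulVec_injective_of_isUnit
  rw [Matrix.isUnit_iff_isUnit_det, (g⁻¹).2]
  exact isUnit_one

/-- The action `g • M = (g⁻¹)ᴴ M g⁻¹`, for which `(g • Q) (g x) = Q x` for forms `Q`. -/
instance posHermAction (K : Type) [RCLike K] (n : ℕ) :
    MulAction (Matrix.SpecialLinearGroup (Fin n) K) (PosHerm K n) where
  smul g M := ⟨(g⁻¹).1ᴴ * M.1 * (g⁻¹).1, posDef_smul g M.2⟩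
  one_smul M := Subtype.ext <| by
    change ((1 : Matrix.SpecialLinearGroup (Fin n) K)⁻¹).1ᴴ * M.1 *
      ((1 : Matrix.SpecialLinearGroup (Fin n) K)⁻¹).1 = M.1
    simp
  mul_smul g h M := Subtype.ext <| by
    change ((g * h)⁻¹).1ᴴ * M.1 * ((g * h)⁻¹).1
      = (g⁻¹).1ᴴ * ((h⁻¹).1ᴴ * M.1 * (h⁻¹).1) * (g⁻¹).1
    rw [mul_inv_rev, Matrix.SpecialLinearGroup.coe_mul, Matrix.conjTranspose_mul]
    simp only [Matrix.mul_assoc]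

lemma posHerm_smul_val {K : Type} [RCLike K] {n : ℕ} (g : Matrix.SpecialLinearGroup (Fin n) K)
    (M : PosHerm K n) : (g • M).1 = (g⁻¹).1ᴴ * M.1 * (g⁻¹).1 := rfl

/-- The induced action on classes. -/
instance hermClassAction (K : Type) [RCLike K] (n : ℕ) :
    MulAction (Matrix.SpecialLinearGroup (Fin n) K) (HermClass K n) where
  smul g := Quotient.map (fun M => g • M) <| by
    rintro M N ⟨c, hc, h⟩
    exact ⟨c, hc, by rw [posHerm_smul_val, posHerm_smul_val, h]; simp⟩
  one_smul := by
    rintro ⟨M⟩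
    exact congrArg PosHerm.cls (one_smul _ M)
  mul_smul g h := by
    rintro ⟨M⟩
    exact congrArg PosHerm.cls (mul_smul g h M)

/-- Entrywise complex conjugation on classes of Hermitian matrices. -/
def HermClass.conj {n : ℕ} : HermClass ℂ n → HermClass ℂ n :=
  Quotient.map
    (fun M => ⟨M.1.map (starRingEnd ℂ), by
      have h := M.2.transpose
      have e : M.1ᵀ = M.1.map (starRingEnd ℂ) := by
        conv_lhs => rw [← M.2.isHermitian]
        rfl
      rwa [e] at h⟩)
    (by
      rintro M N ⟨c, hc, h⟩
      refine ⟨c, hc, ?_⟩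
      ext i j
      simp [h])

lemma posDef_ofReal {n : ℕ} {M : Matrix (Fin n) (Fin n) ℝ} (hM : M.PosDef) :
    (M.map (algebraMap ℝ ℂ)).PosDef := by
  have hsymm : ∀ i j, M i j = M j i := fun i j => by
    have := congrFun (congrFun hM.isHermitian j) i
    simpa using this
  apply Matrix.PosDef.of_dotProduct_mulVec_pos
  · ext i j
    simp [hsymm i j]
  · intro x hx
    set a : Fin n → ℝ := fun i => (x i).re with ha
    set b : Fin n → ℝ := fun i => (x i).im with hb
    have hnn : ∀ v : Fin n → ℝ, 0 ≤ v ⬝ᵥ (M *ᵥ v) := fun v => by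
      simpa using hM.posSemidef.dotProduct_mulVec_nonneg v
    have hpos : ∀ v : Fin n → ℝ, v ≠ 0 → 0 < v ⬝ᵥ (M *ᵥ v) := fun v hv => by
      simpa using hM.dotProduct_mulVec_pos hv
    have hab : 0 < a ⬝ᵥ (M *ᵥ a) + b ⬝ᵥ (M *ᵥ b) := by
      by_cases h : a = 0
      · have hb0 : b ≠ 0 := by
          rintro h'
          apply hx
          ext i
          exact Complex.ext (congrFun h i) (congrFun h' i)
        exact add_pos_of_nonneg_of_pos (hnn a) (hpos b hb0)
      · exact add_pos_of_pos_of_nonneg (hpos a h) (hnn b)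
    have hcross : a ⬝ᵥ (M *ᵥ b) = b ⬝ᵥ (M *ᵥ a) := by
      rw [Matrix.dotProduct_mulVec, ← Matrix.mulVec_transpose,
        show Mᵀ = M from by ext i j; exact hsymm j i, dotProduct_comm]
    have key : star x ⬝ᵥ (M.map (algebraMap ℝ ℂ) *ᵥ x)
        = ((a ⬝ᵥ (M *ᵥ a) + b ⬝ᵥ (M *ᵥ b) : ℝ) : ℂ) := by
      apply Complex.ext
      · simp only [dotProduct, Matrix.mulVec, Finset.mul_sum, Complex.re_sum, Complex.ofReal_re,
          ← Finset.sum_add_distrib]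
        refine Finset.sum_congr rfl fun i _ => Finset.sum_congr rfl fun j _ => ?_
        simp [ha, hb]
      · have h0 : a ⬝ᵥ (M *ᵥ b) - b ⬝ᵥ (M *ᵥ a) = 0 := sub_eq_zero.mpr hcross
        rw [Complex.ofReal_im, ← h0]
        simp only [dotProduct, Matrix.mulVec, Finset.mul_sum, Complex.im_sum,
          ← Finset.sum_sub_distrib]
        refine Finset.sum_congr rfl fun i _ => Finset.sum_congr rfl fun j _ => ?_
        simp [ha, hb]
        ring
    rw [key]
    exact_mod_cast hab

/-- The inclusion of real symmetric classes in Hermitian classes. -/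
def HermClass.ofReal {n : ℕ} : HermClass ℝ n → HermClass ℂ n :=
  Quotient.map (fun M => ⟨M.1.map (algebraMap ℝ ℂ), posDef_ofReal M.2⟩) (by
    rintro M N ⟨c, hc, h⟩
    refine ⟨c, hc, ?_⟩
    ext i j
    simp [h])

/-! ### Complex conjugation on projective space -/

/-- Coordinatewise complex conjugation on `ℂⁿ`. -/
def conjVec (n : ℕ) : (Fin n → ℂ) →ₛₗ[starRingEnd ℂ] (Fin n → ℂ) where
  toFun v := star v
  map_add' v w := star_add v w
  map_smul' c v := by ext i; simp

/-- Coordinatewise complex conjugation on projective space. -/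
def conjProj (n : ℕ) : ℙ ℂ (Fin n → ℂ) → ℙ ℂ (Fin n → ℂ) :=
  Projectivization.map (conjVec n) (star_injective (R := Fin n → ℂ))

lemma conjProj_mk {n : ℕ} (v : Fin n → ℂ) (hv : v ≠ 0) :
    conjProj n (Projectivization.mk ℂ v hv) = Projectivization.mk ℂ (star v) (star_ne_zero.mpr hv) :=
  rfl

lemma conjProj_conjProj {n : ℕ} (x : ℙ ℂ (Fin n → ℂ)) : conjProj n (conjProj n x) = x := by
  induction x using Projectivization.ind with
  | h v hv => simp only [conjProj_mk, star_star]

/-! ### Genus one normal curves -/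

/-- The complex torus `ℂ / Λ`: a curve of genus one over `ℂ`, as a Riemann surface. -/
abbrev Torus (L : PeriodPair) : Type := ℂ ⧸ L.lattice

/-- The point of the torus represented by a complex number. -/
abbrev Torus.pt (L : PeriodPair) (z : ℂ) : Torus L := Submodule.Quotient.mk z

/-- `F` is a nowhere vanishing holomorphic vector of homogeneous coordinates for `f` near the point
represented by `z₀`. -/
def IsLocalLift {L : PeriodPair} {n : ℕ} (f : Torus L → ℙ ℂ (Fin n → ℂ)) (z₀ : ℂ)
    (F : ℂ → Fin n → ℂ) : Prop :=
  AnalyticAt ℂ F z₀ ∧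
    ∀ᶠ z in 𝓝 z₀, ∃ h : F z ≠ 0, f (Torus.pt L z) = Projectivization.mk ℂ (F z) h

/-- `f` is a holomorphic map from the torus to projective space. -/
def IsHolomorphic {L : PeriodPair} {n : ℕ} (f : Torus L → ℙ ℂ (Fin n → ℂ)) : Prop :=
  ∀ z₀ : ℂ, ∃ F, IsLocalLift f z₀ F

/-- `D` is the divisor on the torus cut out, with multiplicities, by the hyperplane
`∑ i, a i * X i = 0`. -/
def IsHyperplaneSection {L : PeriodPair} {n : ℕ} (f : Torus L → ℙ ℂ (Fin n → ℂ))
    (a : Fin n → ℂ) (D : Torus L →₀ ℕ) : Prop :=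
  ∀ (z : ℂ) (F : ℂ → Fin n → ℂ), IsLocalLift f z F →
    analyticOrderAt (fun w => a ⬝ᵥ F w) z = (D (Torus.pt L z) : ℕ∞)

/-- A curve of genus one with a nondegenerate map of degree `n` to `ℙⁿ⁻¹`, which is
an embedding if `n ≥ 3` (and a double cover of the projective line if `n = 2`). -/
structure NormalMap (n : ℕ) where
  /-- The periods of the source. -/
  L : PeriodPair
  /-- The map to projective space. -/
  toFun : Torus L → ℙ ℂ (Fin n → ℂ)
  holomorphic : IsHolomorphic toFun
  /-- The image lies in no hyperplane. -/
  nondegenerate : ∀ a : Fin n → ℂ, a ≠ 0 → ∃ P, a ⬝ᵥ (toFun P).rep ≠ 0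
  /-- Each hyperplane cuts out a divisor of degree `n`. -/
  degree_eq : ∀ a : Fin n → ℂ, a ≠ 0 → ∃ D, IsHyperplaneSection toFun a D ∧ D.degree = n
  injective : 3 ≤ n → Function.Injective toFun
  immersion : 3 ≤ n → ∀ z F, IsLocalLift toFun z F → LinearIndependent ℂ ![F z, deriv F z]

/-- The image in `ℙⁿ⁻¹`; for `n = 2`, the set of the points over which the double cover is
ramified. -/
def NormalMap.locus {n : ℕ} (m : NormalMap n) : Set (ℙ ℂ (Fin n → ℂ)) :=
  if n = 2 then {q | ∃! P, m.toFun P = q} else Set.range m.toFun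

/-- The Heisenberg group: the lifts to `SL_n` of the projective transformations which extend the
translations by `n`-torsion points. -/
def NormalMap.heisenberg {n : ℕ} (m : NormalMap n) :
    Subgroup (Matrix.SpecialLinearGroup (Fin n) ℂ) where
  carrier := {h | ∃ T : Torus m.L, n • T = 0 ∧ ∀ P, h • m.toFun P = m.toFun (P + T)}
  one_mem' := ⟨0, by simp, fun P => by simp⟩
  mul_mem' := by
    rintro g h ⟨S, hS, hg⟩ ⟨T, hT, hh⟩
    refine ⟨T + S, by rw [smul_add, hS, hT, add_zero], fun P => ?_⟩
    rw [mul_smul, hh, hg, add_assoc]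
  inv_mem' := by
    rintro g ⟨S, hS, hg⟩
    refine ⟨-S, by rw [smul_neg, hS, neg_zero], fun P => ?_⟩
    rw [inv_smul_eq_iff, hg, neg_add_cancel_right]

/-- Genus one normal curves of degree `n` over `ℂ` in a fixed `ℙⁿ⁻¹`; for `n = 2`, sets of
ramification points of double covers. -/
def NormalCurve (n : ℕ) : Type :=
  {C : Set (ℙ ℂ (Fin n → ℂ)) // ∃ m : NormalMap n, m.locus = C}

/-! ### Change of coordinates -/

lemma IsLocalLift.smul {L : PeriodPair} {n : ℕ} {f : Torus L → ℙ ℂ (Fin n → ℂ)} {z₀ : ℂ}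
    {F : ℂ → Fin n → ℂ} (hF : IsLocalLift f z₀ F) (g : Matrix.SpecialLinearGroup (Fin n) ℂ) :
    IsLocalLift (fun P => g • f P) z₀ (fun z => g • F z) := by
  refine ⟨?_, hF.2.mono fun z ⟨h, e⟩ => ⟨(smul_ne_zero_iff_ne g).mpr h, ?_⟩⟩
  · exact ((Matrix.mulVecLin g.1).toContinuousLinearMap.analyticAt _).comp hF.1
  · change g • f (Torus.pt L z) = _
    rw [e, Projectivization.smul_mk]

lemma dotProduct_sl_smul {n : ℕ} (g : Matrix.SpecialLinearGroup (Fin n) ℂ) (a v : Fin n → ℂ) :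
    a ⬝ᵥ (g • v) = (a ᵥ* g.1) ⬝ᵥ v :=
  Matrix.dotProduct_mulVec a g.1 v

lemma vecMul_sl_ne_zero {n : ℕ} (g : Matrix.SpecialLinearGroup (Fin n) ℂ) {a : Fin n → ℂ}
    (ha : a ≠ 0) : a ᵥ* g.1 ≠ 0 := by
  intro h
  apply ha
  have := congrArg (fun v => v ᵥ* (g⁻¹).1) h
  simp only [Matrix.vecMul_vecMul, ← Matrix.SpecialLinearGroup.coe_mul, mul_inv_cancel,
    Matrix.SpecialLinearGroup.coe_one, Matrix.vecMul_one, Matrix.zero_vecMul] at this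
  exact this

lemma dotProduct_rep_ne_zero_iff {n : ℕ} (a v : Fin n → ℂ) (hv : v ≠ 0) :
    a ⬝ᵥ (Projectivization.mk ℂ v hv).rep ≠ 0 ↔ a ⬝ᵥ v ≠ 0 := by
  obtain ⟨c, hc⟩ := Projectivization.exists_smul_eq_mk_rep ℂ v hv
  rw [← hc, Units.smul_def, dotProduct_smul, smul_eq_mul]
  simp

/-- Composition with a linear change of coordinates. -/
def NormalMap.smul {n : ℕ} (g : Matrix.SpecialLinearGroup (Fin n) ℂ) (m : NormalMap n) :
    NormalMap n where
  L := m.L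
  toFun P := g • m.toFun P
  holomorphic z := by
    obtain ⟨F, hF⟩ := m.holomorphic z
    exact ⟨_, hF.smul g⟩
  nondegenerate a ha := by
    obtain ⟨P, hP⟩ := m.nondegenerate _ (vecMul_sl_ne_zero g ha)
    refine ⟨P, ?_⟩
    revert hP
    induction m.toFun P using Projectivization.ind with
    | h v hv =>
      rw [Projectivization.smul_mk, dotProduct_rep_ne_zero_iff, dotProduct_rep_ne_zero_iff,
        dotProduct_sl_smul]
      exact id
  degree_eq a ha := by
    obtain ⟨D, hD, hn⟩ := m.degree_eq _ (vecMul_sl_ne_zero g ha)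
    refine ⟨D, fun z F hF => ?_, hn⟩
    have h := hF.smul g⁻¹
    simp only [inv_smul_smul] at h
    have := hD z _ h
    simpa only [← dotProduct_sl_smul, smul_inv_smul] using this
  injective hn := (MulAction.injective g).comp (m.injective hn)
  immersion hn z F hF := by
    have h := hF.smul g⁻¹
    simp only [inv_smul_smul] at h
    have hl := m.immersion hn z _ h
    have hd : deriv (fun z => g⁻¹ • F z) z = g⁻¹ • deriv F z :=
      ((Matrix.mulVecLin (g⁻¹).1).toContinuousLinearMap.hasFDerivAt.comp_hasDerivAt z
        hF.1.differentiableAt.hasDerivAt).deriv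
    rw [hd] at hl
    refine LinearIndependent.of_comp (Matrix.mulVecLin (g⁻¹).1) ?_
    convert hl using 1
    ext i : 1
    fin_cases i <;> rfl

lemma NormalMap.locus_smul {n : ℕ} (g : Matrix.SpecialLinearGroup (Fin n) ℂ) (m : NormalMap n) :
    (m.smul g).locus = g • m.locus := by
  unfold NormalMap.locus
  split_ifs
  · ext q
    rw [Set.mem_smul_set_iff_inv_smul_mem]
    simp only [Set.mem_ofPred_eq, NormalMap.smul, ← eq_inv_smul_iff]
  · ext q
    rw [Set.mem_smul_set_iff_inv_smul_mem]
    simp only [Set.mem_range, NormalMap.smul, ← eq_inv_smul_iff]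

/-- The action of `SL_n(ℂ)` on genus one normal curves. -/
instance normalCurveAction (n : ℕ) :
    MulAction (Matrix.SpecialLinearGroup (Fin n) ℂ) (NormalCurve n) where
  smul g C := ⟨g • C.1, by
    obtain ⟨m, hm⟩ := C.2
    exact ⟨m.smul g, by rw [m.locus_smul, hm]⟩⟩
  one_smul C := Subtype.ext (one_smul _ C.1)
  mul_smul g h C := Subtype.ext (mul_smul g h C.1)

/-! ### Conjugate curves -/

/-- The complex conjugate periods. -/
def conjPeriods (L : PeriodPair) : PeriodPair where
  ω₁ := conj L.ω₁
  ω₂ := conj L.ω₂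
  indep := by
    have h := L.indep
    rw [LinearIndependent.pair_iff] at h ⊢
    intro s t hst
    apply h s t
    have := congrArg conj hst
    simpa using this

/-- Complex conjugation `ℂ / Λ̄ → ℂ / Λ`. -/
def conjTorus (L : PeriodPair) : Torus (conjPeriods L) ≃ₗ[ℤ] Torus L :=
  Submodule.Quotient.equiv _ _ (starAddEquiv (R := ℂ)).toIntLinearEquiv (by
    rw [PeriodPair.lattice, PeriodPair.lattice, Submodule.map_span, Set.image_pair]
    simp [conjPeriods])

lemma conjTorus_pt (L : PeriodPair) (z : ℂ) :
    conjTorus L (Torus.pt (conjPeriods L) z) = Torus.pt L (star z) := rfl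

lemma analyticAt_star_star {n : ℕ} {F : ℂ → Fin n → ℂ} {z : ℂ} (hF : AnalyticAt ℂ F z) :
    AnalyticAt ℂ (star ∘ F ∘ star) (star z) := by
  rw [Complex.analyticAt_iff_eventually_differentiableAt] at hF ⊢
  have h : Filter.Tendsto (star : ℂ → ℂ) (𝓝 (star z)) (𝓝 z) := by
    simpa using (continuous_star (R := ℂ)).tendsto (star z)
  filter_upwards [h.eventually hF] with w hw
  simpa using hw.star_star

lemma analyticOrderAt_conj_conj {f : ℂ → ℂ} {z : ℂ} (hf : AnalyticAt ℂ f z) :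
    analyticOrderAt (star ∘ f ∘ star) (star z) = analyticOrderAt f z := by
  have aux : ∀ {f : ℂ → ℂ} {z : ℂ}, AnalyticAt ℂ f z → AnalyticAt ℂ (star ∘ f ∘ star) (star z) := by
    intro f z hf
    rw [Complex.analyticAt_iff_eventually_differentiableAt] at hf ⊢
    have h : Filter.Tendsto (star : ℂ → ℂ) (𝓝 (star z)) (𝓝 z) := by
      simpa using (continuous_star (R := ℂ)).tendsto (star z)
    filter_upwards [h.eventually hf] with w hw
    simpa using hw.star_star
  have ht : Filter.Tendsto (star : ℂ → ℂ) (𝓝 (star z)) (𝓝 z) := by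
    simpa using (continuous_star (R := ℂ)).tendsto (star z)
  cases hk : analyticOrderAt f z with
  | top =>
    rw [analyticOrderAt_eq_top] at hk ⊢
    filter_upwards [ht.eventually hk] with w hw
    rw [Function.comp_apply, Function.comp_apply, hw, star_zero]
  | coe k =>
    have hk' := (hf.analyticOrderAt_eq_natCast).mp hk
    obtain ⟨g, hg, hg0, he⟩ := hk'
    refine ((aux hf).analyticOrderAt_eq_natCast).mpr ⟨star ∘ g ∘ star, aux hg, by simpa, ?_⟩
    filter_upwards [ht.eventually he] with w hw
    rw [Function.comp_apply, Function.comp_apply, hw]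
    simp

lemma IsLocalLift.conj {L L' : PeriodPair} {n : ℕ} {f : Torus L → ℙ ℂ (Fin n → ℂ)}
    {f' : Torus L' → ℙ ℂ (Fin n → ℂ)}
    (hf : ∀ z : ℂ, f' (Torus.pt L' z) = conjProj n (f (Torus.pt L (star z)))) {z₀ : ℂ}
    {F : ℂ → Fin n → ℂ} (hF : IsLocalLift f z₀ F) :
    IsLocalLift f' (star z₀) (star ∘ F ∘ star) := by
  refine ⟨analyticAt_star_star hF.1, ?_⟩
  have h : Filter.Tendsto (star : ℂ → ℂ) (𝓝 (star z₀)) (𝓝 z₀) := by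
    simpa using (continuous_star (R := ℂ)).tendsto (star z₀)
  filter_upwards [h.eventually hF.2] with z ⟨hz, e⟩
  exact ⟨star_ne_zero.mpr hz, by rw [hf, e, conjProj_mk]; rfl⟩

/-- The complex conjugate of a map to projective space. -/
def NormalMap.conj {n : ℕ} (m : NormalMap n) : NormalMap n where
  L := conjPeriods m.L
  toFun P := conjProj n (m.toFun (conjTorus m.L P))
  holomorphic z := by
    obtain ⟨F, hF⟩ := m.holomorphic (star z)
    have h := hF.conj (f' := fun P => conjProj n (m.toFun (conjTorus m.L P))) (fun _ => rfl)
    rw [star_star] at h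
    exact ⟨_, h⟩
  nondegenerate a ha := by
    obtain ⟨P, hP⟩ := m.nondegenerate (star a) (star_ne_zero.mpr ha)
    refine ⟨(conjTorus m.L).symm P, ?_⟩
    rw [LinearEquiv.apply_symm_apply]
    revert hP
    induction m.toFun P using Projectivization.ind with
    | h v hv =>
      rw [conjProj_mk, dotProduct_rep_ne_zero_iff, dotProduct_rep_ne_zero_iff]
      intro h h'
      apply h
      rw [← star_star v, Matrix.star_dotProduct_star, dotProduct_comm, h', star_zero]
  degree_eq a ha := by
    obtain ⟨D, hD, hn⟩ := m.degree_eq (star a) (star_ne_zero.mpr ha)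
    refine ⟨D.mapDomain (conjTorus m.L).symm, fun z F hF => ?_, ?_⟩
    · have h := hF.conj (f' := m.toFun) (fun w => by
        rw [conjTorus_pt, star_star, conjProj_conjProj])
      have h2 := hD _ _ h
      rw [← conjTorus_pt] at h2
      have e : D.mapDomain (conjTorus m.L).symm (Torus.pt (conjPeriods m.L) z)
          = D (conjTorus m.L (Torus.pt (conjPeriods m.L) z)) := by
        conv_lhs => rw [← (conjTorus m.L).symm_apply_apply (Torus.pt (conjPeriods m.L) z)]
        exact Finsupp.mapDomain_apply (conjTorus m.L).symm.injective _ _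
      rw [e, ← h2]
      have ha : AnalyticAt ℂ (fun w => a ⬝ᵥ F w) z := by
        have : AnalyticAt ℂ (fun w => ∑ i, a i * F w i) z :=
          Finset.analyticAt_fun_sum _ fun i _ =>
            analyticAt_const.mul ((analyticAt_pi_iff.mp hF.1) i)
        exact this
      rw [← analyticOrderAt_conj_conj ha]
      congr 1
      ext w
      simp [Matrix.star_dotProduct_star, dotProduct_comm]
    · rw [Finsupp.degree_mapDomain, hn]
  injective hn := fun P Q h => by
    have h1 := congrArg (conjProj n) h
    simp only [conjProj_conjProj] at h1
    exact (conjTorus m.L).injective (m.injective hn h1)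
  immersion hn z F hF := by
    have h := hF.conj (f' := m.toFun) (fun w => by
        rw [conjTorus_pt, star_star, conjProj_conjProj])
    have hl := m.immersion hn _ _ h
    have hd : deriv (star ∘ F ∘ star) (star z) = star (deriv F z) := by simp
    rw [hd] at hl
    rw [LinearIndependent.pair_iff] at hl ⊢
    intro s t hst
    have := hl (star s) (star t) (by
      have h3 := congrArg star hst
      simpa using h3)
    simpa using this

lemma NormalMap.locus_conj {n : ℕ} (m : NormalMap n) :
    m.conj.locus = conjProj n '' m.locus := by
  have key : ∀ x y, conjProj n x = y ↔ x = conjProj n y := fun x y =>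
    ⟨fun h => by rw [← h, conjProj_conjProj], fun h => by rw [h, conjProj_conjProj]⟩
  have hinv : Function.Involutive (conjProj n) := conjProj_conjProj
  unfold NormalMap.locus
  rw [Set.image_eq_preimage_of_inverse hinv.leftInverse hinv.rightInverse]
  split_ifs
  · ext q
    simp only [Set.mem_ofPred_eq, NormalMap.conj, key, Set.mem_preimage]
    exact (conjTorus m.L).toEquiv.existsUnique_congr (fun _ => Iff.rfl)
  · ext q
    simp only [Set.mem_range, NormalMap.conj, key, Set.mem_preimage]
    exact (conjTorus m.L).toEquiv.exists_congr (fun _ => Iff.rfl)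

/-- The complex conjugate curve. -/
def NormalCurve.conj {n : ℕ} (C : NormalCurve n) : NormalCurve n :=
  ⟨conjProj n '' C.1, by
    obtain ⟨m, hm⟩ := C.2
    exact ⟨m.conj, by rw [m.locus_conj, hm]⟩⟩

/-! ### Real curves -/

/-- The set of complex projective zeros of a set of real polynomials. -/
def zeroLocus {n : ℕ} (S : Set (MvPolynomial (Fin n) ℝ)) : Set (ℙ ℂ (Fin n → ℂ)) :=
  {x | ∀ p ∈ S, MvPolynomial.aeval x.rep p = 0}

/-- The curve is defined over `ℝ`: it is cut out by real homogeneous polynomials. -/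
def NormalCurve.IsReal {n : ℕ} (C : NormalCurve n) : Prop :=
  ∃ S : Set (MvPolynomial (Fin n) ℝ), (∀ p ∈ S, ∃ d, p.IsHomogeneous d) ∧ C.1 = zeroLocus S

/-- Genus one normal curves of degree `n` defined over `ℝ`. -/
def RealNormalCurve (n : ℕ) : Type := {C : NormalCurve n // C.IsReal}

/-- A real matrix as a complex matrix. -/
def slOfReal {n : ℕ} (g : Matrix.SpecialLinearGroup (Fin n) ℝ) :
    Matrix.SpecialLinearGroup (Fin n) ℂ :=
  Matrix.SpecialLinearGroup.map (algebraMap ℝ ℂ) g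

/-- The polynomial `p (g⁻¹ X)`. -/
def substInv {n : ℕ} (g : Matrix.SpecialLinearGroup (Fin n) ℝ) (p : MvPolynomial (Fin n) ℝ) :
    MvPolynomial (Fin n) ℝ :=
  MvPolynomial.aeval
    (fun i => ∑ j, MvPolynomial.C ((g⁻¹).1 i j) * MvPolynomial.X (R := ℝ) j) p

lemma substInv_isHomogeneous {n : ℕ} (g : Matrix.SpecialLinearGroup (Fin n) ℝ)
    {p : MvPolynomial (Fin n) ℝ} {d : ℕ} (hp : p.IsHomogeneous d) :
    (substInv g p).IsHomogeneous d := by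
  have := hp.aeval (n := 1)
    (fun i => ∑ j, MvPolynomial.C ((g⁻¹).1 i j) * MvPolynomial.X (R := ℝ) j)
    (fun i => MvPolynomial.IsHomogeneous.sum _ _ _ fun j _ =>
      MvPolynomial.isHomogeneous_C_mul_X _ _)
  rwa [one_mul] at this

lemma aeval_substInv {n : ℕ} (g : Matrix.SpecialLinearGroup (Fin n) ℝ)
    (p : MvPolynomial (Fin n) ℝ) (v : Fin n → ℂ) :
    MvPolynomial.aeval v (substInv g p) = MvPolynomial.aeval ((slOfReal g)⁻¹ • v) p := by
  rw [substInv, ← AlgHom.comp_apply, MvPolynomial.comp_aeval]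
  congr 2
  ext i
  rw [slOfReal, ← map_inv]
  have e : ∀ j, ((g⁻¹).1 i j : ℂ) = (Matrix.SpecialLinearGroup.map (algebraMap ℝ ℂ) g⁻¹).1 i j :=
    fun j => rfl
  simp only [map_sum, map_mul, MvPolynomial.aeval_C, MvPolynomial.aeval_X,
    Complex.coe_algebraMap, e]
  rfl

lemma aeval_rep_eq_zero_iff {n : ℕ} {p : MvPolynomial (Fin n) ℝ} {d : ℕ} (hp : p.IsHomogeneous d)
    (v : Fin n → ℂ) (hv : v ≠ 0) :
    MvPolynomial.aeval (Projectivization.mk ℂ v hv).rep p = 0 ↔ MvPolynomial.aeval v p = 0 := by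
  obtain ⟨c, hc⟩ := Projectivization.exists_smul_eq_mk_rep ℂ v hv
  have e : MvPolynomial.aeval ((c : ℂ) • v) p = (c : ℂ) ^ d * MvPolynomial.aeval v p := by
    rw [MvPolynomial.aeval_def, MvPolynomial.aeval_def, MvPolynomial.eval₂_eq',
      MvPolynomial.eval₂_eq', Finset.mul_sum]
    refine Finset.sum_congr rfl fun m hm => ?_
    have hm' : ∑ i, m i = d := by
      have h1 := hp (MvPolynomial.mem_support_iff.mp hm)
      rw [← h1, Finsupp.weight_apply, Finsupp.sum_fintype _ _ (fun _ => by simp)]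
      simp
    simp only [Pi.smul_apply, smul_eq_mul, mul_pow, Finset.prod_mul_distrib,
      Finset.prod_pow_eq_pow_sum, hm']
    ring
  rw [← hc, Units.smul_def, e]
  simp

lemma smul_zeroLocus {n : ℕ} (g : Matrix.SpecialLinearGroup (Fin n) ℝ)
    {S : Set (MvPolynomial (Fin n) ℝ)} (hS : ∀ p ∈ S, ∃ d, p.IsHomogeneous d) :
    slOfReal g • zeroLocus S = zeroLocus (substInv g '' S) := by
  ext x
  rw [Set.mem_smul_set_iff_inv_smul_mem]
  simp only [zeroLocus, Set.mem_ofPred_eq, Set.forall_mem_image]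
  refine forall₂_congr fun p hp => ?_
  obtain ⟨d, hd⟩ := hS p hp
  induction x using Projectivization.ind with
  | h v hv =>
    rw [Projectivization.smul_mk, aeval_rep_eq_zero_iff hd,
      aeval_rep_eq_zero_iff (substInv_isHomogeneous g hd), aeval_substInv]

/-- The action of `SL_n(ℝ)` on genus one normal curves defined over `ℝ`. -/
instance realNormalCurveAction (n : ℕ) :
    MulAction (Matrix.SpecialLinearGroup (Fin n) ℝ) (RealNormalCurve n) where
  smul g C := ⟨slOfReal g • C.1, by
    obtain ⟨S, hS, e⟩ := C.2
    refine ⟨substInv g '' S, ?_, ?_⟩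
    · rintro _ ⟨p, hp, rfl⟩
      obtain ⟨d, hd⟩ := hS p hp
      exact ⟨d, substInv_isHomogeneous g hd⟩
    · rw [← smul_zeroLocus g hS, ← e]
      rfl⟩
  one_smul C := Subtype.ext <| by
    change slOfReal 1 • C.1 = C.1
    rw [slOfReal, map_one, one_smul]
  mul_smul g h C := Subtype.ext <| by
    change slOfReal (g * h) • C.1 = slOfReal g • slOfReal h • C.1
    rw [slOfReal, map_mul, mul_smul]
    rfl

/-- Equivariance for `SL_n(ℂ)`. -/
def IsCovariant {n : ℕ} (φ : NormalCurve n → HermClass ℂ n) : Prop :=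
  ∀ (g : Matrix.SpecialLinearGroup (Fin n) ℂ) (C : NormalCurve n), φ (g • C) = g • φ C

end GenusOne

end

open scoped Matrix Topology ComplexOrder LinearAlgebra.Projectivization Pointwise ComplexConjugate

noncomputable section

namespace GenusOne

/-! Write the source of a degree `n` map as `ℂ / ω(ℤ + ℤτ)`. Its homogeneous coordinates lift to
entire theta functions with a common multiplier (`NormalMap.nonempty_thetaLift`). The space of all
such functions has dimension at most `n` (`rank_thetaSpace_le`), so by nondegeneracy the coordinates
are a basis of it. The translations by `1/n` and `τ/n` preserve this space up to a nowhere zero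
factor, hence come from matrices `a`, `b` of determinant one, and comparing the factors gives `b a =
ζ a b` with `ζ = e(1/n)` a primitive root of unity (`exists_heisenberg_pair`).

Such a pair has, up to a positive factor, exactly one invariant positive definite form
(`exists_unique_invariant_form`). Averaging over the products `a^j b^k` gives existence. For
uniqueness, `a` has distinct eigenvalues of norm one, so its eigenvectors are orthogonal for every
invariant form, and `b` moves them along one cycle, so they have equal length. The rest of the
Heisenberg group consists of words in `a`, `b` times scalar roots of unity, which preserve every
form.

The Heisenberg group depends only on the curve, not on its parametrization
(`heisenberg_eq_of_locus_eq`). For `n ≥ 3`, two embeddings with the same image differ by an affine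
map `u ↦ αu + β` of universal covers, which carries translations to translations. For `n = 2`, the
fibres are the pairs `{P, G - P}`, the ramification points come from the solutions of `2P = G`, and
translation by a two-torsion point permutes these four points in a way that is determined by the
image of one of them.

Sending a curve to its invariant class is covariant because Heisenberg groups are conjugated along
with curves. Conversely, the Heisenberg group stabilizes its curve, so it fixes the value of any
covariant map there, and determinants turn the fixed class into a fixed form: this is uniqueness.
Compatibility with conjugation is uniqueness applied to the conjugated map, and a
conjugation-invariant class contains a real matrix. -/

/-! ### The exponential `exp (2πiz)` -/

/-- The function `exp (2πiz)`. -/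
def ex (z : ℂ) : ℂ := Complex.exp (2 * Real.pi * Complex.I * z)

lemma ex_add (z w : ℂ) : ex (z + w) = ex z * ex w := by
  rw [ex, mul_add, Complex.exp_add]; rfl

@[simp] lemma ex_zero : ex 0 = 1 := by simp [ex]

lemma ex_ne_zero (z : ℂ) : ex z ≠ 0 := Complex.exp_ne_zero _

lemma ex_neg (z : ℂ) : ex (-z) = (ex z)⁻¹ := by
  rw [ex, mul_neg, Complex.exp_neg]; rfl

lemma ex_sub (z w : ℂ) : ex (z - w) = ex z / ex w := by
  rw [sub_eq_add_neg, ex_add, ex_neg, div_eq_mul_inv]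

lemma ex_eq_one_iff {z : ℂ} : ex z = 1 ↔ ∃ k : ℤ, z = k := by
  rw [ex, Complex.exp_eq_one_iff]
  refine exists_congr fun k => ?_
  have h : (2 * Real.pi * Complex.I : ℂ) ≠ 0 := Complex.two_pi_I_ne_zero
  rw [mul_comm (k : ℂ), mul_right_inj' h]

@[simp] lemma ex_intCast (k : ℤ) : ex k = 1 := ex_eq_one_iff.mpr ⟨k, rfl⟩

@[simp] lemma ex_one : ex 1 = 1 := by simpa using ex_intCast 1

lemma exists_ex_eq {c : ℂ} (hc : c ≠ 0) : ∃ z, ex z = c := by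
  refine ⟨Complex.log c / (2 * Real.pi * Complex.I), ?_⟩
  rw [ex, mul_div_cancel₀ _ Complex.two_pi_I_ne_zero, Complex.exp_log hc]

lemma norm_ex (z : ℂ) : ‖ex z‖ = Real.exp (-(2 * Real.pi * z.im)) := by
  rw [ex, Complex.norm_exp]
  congr 1
  simp

lemma norm_ex_lt_one {τ : ℂ} (hτ : 0 < τ.im) : ‖ex τ‖ < 1 := by
  rw [norm_ex, Real.exp_lt_one_iff, neg_lt_zero]
  positivity

@[fun_prop] lemma differentiable_ex : Differentiable ℂ ex := by
  unfold ex; fun_prop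

lemma ex_nsmul (k : ℕ) (z : ℂ) : ex (k * z) = ex z ^ k := by
  rw [ex, ex, ← Complex.exp_nat_mul]; congr 1; ring

/-! ### The product `∏ (1 - q ^ m x)` -/

/-- The product `∏ (1 - q ^ m x)` over all `m ≥ 0`. -/
def eulerProd (q x : ℂ) : ℂ := ∏' m : ℕ, (1 + -(q ^ m * x))

lemma summable_eulerProd {q : ℂ} (hq : ‖q‖ < 1) (x : ℂ) :
    Summable fun m : ℕ => ‖-(q ^ m * x)‖ := by
  simp only [norm_neg, norm_mul, norm_pow]
  exact (summable_geometric_of_lt_one (norm_nonneg _) hq).mul_right _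

lemma differentiable_eulerProd {q : ℂ} (hq : ‖q‖ < 1) : Differentiable ℂ (eulerProd q) := by
  have h : HasProdLocallyUniformlyOn (fun (m : ℕ) (x : ℂ) => 1 + -(q ^ m * x)) (eulerProd q)
      Set.univ := by
    apply hasProdLocallyUniformlyOn_of_forall_compact isOpen_univ
    intro K _ hK
    obtain ⟨R, hR⟩ := hK.isBounded.exists_norm_le
    refine Summable.hasProdUniformlyOn_nat_one_add (u := fun m => ‖q‖ ^ m * R) hK
      ((summable_geometric_of_lt_one (norm_nonneg _) hq).mul_right _)
      (.of_forall fun m x hx => ?_) (fun _ => by fun_prop)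
    rw [norm_neg, norm_mul, norm_pow]
    exact mul_le_mul_of_nonneg_left (hR x hx) (by positivity)
  rw [← differentiableOn_univ]
  exact h.differentiableOn
    (.of_forall fun _ => by
      simpa [Finset.prod_fn] using DifferentiableOn.finsetProd (fun _ _ => by fun_prop))
    isOpen_univ

/-- The factor `m = 0` splits off. Both the quasi-periodicity of `theta` and its simple zero at the
origin come from this. -/
lemma eulerProd_eq {q : ℂ} (hq : ‖q‖ < 1) (x : ℂ) :
    eulerProd q x = (1 - x) * eulerProd q (q * x) := by
  have h : Multipliable fun m : ℕ => (1 + -(q ^ (m + 1) * x)) :=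
    multipliable_one_add_of_summable ((summable_nat_add_iff 1).mpr (summable_eulerProd hq x))
  have h1 : eulerProd q x = (1 + -(q ^ 0 * x)) * ∏' m : ℕ, (1 + -(q ^ (m + 1) * x)) :=
    tprod_eq_zero_mul' (f := fun m : ℕ => 1 + -(q ^ m * x)) h
  have h2 : ∀ m : ℕ, 1 + -(q ^ (m + 1) * x) = 1 + -(q ^ m * (q * x)) := fun m => by ring
  rw [h1, tprod_congr h2, pow_zero, one_mul, ← sub_eq_add_neg]
  rfl

lemma eulerProd_ne_zero {q x : ℂ} (hq : ‖q‖ < 1) (h : ∀ m : ℕ, q ^ m * x ≠ 1) :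
    eulerProd q x ≠ 0 := by
  refine tprod_one_add_ne_zero_of_summable (f := fun m : ℕ => -(q ^ m * x)) ?_
    (summable_eulerProd hq x)
  intro m h'
  exact h m (by linear_combination -h')

/-! ### A theta function with simple zeros at the lattice points -/

/-- An entire function with simple zeros at the points of `ℤ + ℤτ`. -/
def theta (τ z : ℂ) : ℂ := eulerProd (ex τ) (ex z) * eulerProd (ex τ) (ex (τ - z))

lemma differentiable_theta {τ : ℂ} (hτ : 0 < τ.im) : Differentiable ℂ (theta τ) := by
  have h := differentiable_eulerProd (norm_ex_lt_one hτ)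
  unfold theta
  exact (h.comp differentiable_ex).mul (h.comp (differentiable_ex.comp (by fun_prop)))

lemma theta_add_one (τ z : ℂ) : theta τ (z + 1) = theta τ z := by
  rw [theta, theta, ex_add, ex_one, mul_one, show τ - (z + 1) = τ - z - 1 by ring, ex_sub, ex_one,
    div_one]

lemma theta_add_tau {τ : ℂ} (hτ : 0 < τ.im) (z : ℂ) : theta τ (z + τ) = -ex (-z) * theta τ z := by
  have h := norm_ex_lt_one hτ
  rw [theta, theta, eulerProd_eq h (ex z), show τ - (z + τ) = -z by ring,
    eulerProd_eq h (ex (-z)), ← ex_add, ← ex_add, ← sub_eq_add_neg, add_comm z τ]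
  have h1 : ex (-z) * ex z = 1 := by rw [← ex_add]; simp
  linear_combination -(eulerProd (ex τ) (ex (τ + z)) * eulerProd (ex τ) (ex (τ - z))) * h1

lemma theta_ne_zero {τ : ℂ} (hτ : 0 < τ.im) {z : ℂ} (hz : ∀ p q : ℤ, z ≠ p + q * τ) :
    theta τ z ≠ 0 := by
  have h := norm_ex_lt_one hτ
  refine mul_ne_zero (eulerProd_ne_zero h fun m hm => ?_) (eulerProd_ne_zero h fun m hm => ?_)
  · rw [← ex_nsmul, ← ex_add, ex_eq_one_iff] at hm
    obtain ⟨k, hk⟩ := hm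
    exact hz k (-m) (by push_cast; linear_combination hk)
  · rw [← ex_nsmul, ← ex_add, ex_eq_one_iff] at hm
    obtain ⟨k, hk⟩ := hm
    exact hz (-k) (m + 1) (by push_cast; linear_combination -hk)

lemma theta_zero (τ : ℂ) (hτ : 0 < τ.im) : theta τ 0 = 0 ∧ deriv (theta τ) 0 ≠ 0 := by
  have h := norm_ex_lt_one hτ
  set r : ℂ → ℂ := fun z => eulerProd (ex τ) (ex τ * ex z) * eulerProd (ex τ) (ex (τ - z)) with hr
  have he : theta τ = fun z => (1 - ex z) * r z := by
    ext z
    rw [theta, eulerProd_eq h, hr]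
    ring
  have hdr : Differentiable ℂ r := by
    have h' := differentiable_eulerProd h
    exact (h'.comp (differentiable_ex.const_mul _)).mul
      (h'.comp (differentiable_ex.comp (by fun_prop)))
  -- The remaining factors `1 - q ^ (m + 1)` do not vanish because `|q| < 1`, so the zero at the
  -- origin is that of `1 - ex z` and is simple.
  have hne : eulerProd (ex τ) (ex τ) ≠ 0 := by
    refine eulerProd_ne_zero h fun m hm => ?_
    have h1 : ‖ex τ ^ m * ex τ‖ < 1 := by
      rw [← pow_succ, norm_pow]
      exact pow_lt_one₀ (norm_nonneg _) h (Nat.succ_ne_zero m)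
    rw [hm, norm_one] at h1
    exact lt_irrefl _ h1
  have hr0 : r 0 ≠ 0 := by simpa [hr] using hne
  have hde : HasDerivAt ex (2 * Real.pi * Complex.I) 0 := by
    have := ((hasDerivAt_id (0 : ℂ)).const_mul (2 * Real.pi * Complex.I : ℂ)).cexp
    simpa [ex] using! this
  have hd : HasDerivAt (theta τ) (-(2 * Real.pi * Complex.I) * r 0) 0 := by
    rw [he]
    have := (hde.const_sub 1).mul (hdr 0).hasDerivAt
    simpa using! this
  refine ⟨by simp [he], ?_⟩
  rw [hd.deriv]
  exact mul_ne_zero (neg_ne_zero.mpr Complex.two_pi_I_ne_zero) hr0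

/-- Translation by a period multiplies `theta` by a nowhere zero entire function, which does not
change orders of vanishing. -/
lemma analyticOrderAt_theta_add {τ : ℂ} (hτ : 0 < τ.im) (z : ℂ) (p q : ℤ) :
    analyticOrderAt (theta τ) (z + (p + q * τ)) = analyticOrderAt (theta τ) z := by
  have hθ := differentiable_theta hτ
  have ht : ∀ w z : ℂ, analyticOrderAt (theta τ) (z + w)
      = analyticOrderAt (fun z => theta τ (z + w)) z := fun w z => by
    have hg : AnalyticAt ℂ (fun z : ℂ => z + w) z := by fun_prop
    exact (analyticOrderAt_comp_of_deriv_ne_zero (f := theta τ) hg (by simp)).symm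
  have h1 : ∀ z, analyticOrderAt (theta τ) (z + 1) = analyticOrderAt (theta τ) z := fun z => by
    rw [ht]
    simp only [theta_add_one]
  have h2 : ∀ z, analyticOrderAt (theta τ) (z + τ) = analyticOrderAt (theta τ) z := fun z => by
    have hu : Differentiable ℂ fun z => -ex (-z) := (differentiable_ex.comp (by fun_prop)).neg
    have e : (fun z => theta τ (z + τ)) = (fun z => -ex (-z)) * theta τ := by
      ext z
      exact theta_add_tau hτ z
    rw [ht, e, analyticOrderAt_mul (hu.analyticAt z) (hθ.analyticAt z),
      (hu.analyticAt z).analyticOrderAt_eq_zero.mpr (neg_ne_zero.mpr (ex_ne_zero _)), zero_add]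
  have h1' : Function.Periodic (analyticOrderAt (theta τ)) 1 := h1
  have h2' : Function.Periodic (analyticOrderAt (theta τ)) τ := h2
  rw [← add_assoc, h2'.int_mul q, ← mul_one (p : ℂ), h1'.int_mul p]

lemma analyticOrderAt_theta {τ : ℂ} (hτ : 0 < τ.im) (p q : ℤ) :
    analyticOrderAt (theta τ) (p + q * τ) = 1 := by
  rw [← zero_add (p + q * τ : ℂ), analyticOrderAt_theta_add hτ]
  exact ((differentiable_theta hτ).analyticAt 0).analyticOrderAt_eq_one_of_zero_deriv_ne_zero
    (theta_zero τ hτ).1 (theta_zero τ hτ).2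

lemma theta_eq_zero_iff {τ : ℂ} (hτ : 0 < τ.im) (z : ℂ) :
    theta τ z = 0 ↔ ∃ p q : ℤ, z = p + q * τ := by
  refine ⟨fun h => ?_, ?_⟩
  · by_contra! h'
    exact theta_ne_zero hτ h' h
  · rintro ⟨p, q, rfl⟩
    apply apply_eq_zero_of_analyticOrderAt_ne_zero (𝕜 := ℂ)
    rw [analyticOrderAt_theta hτ]
    exact one_ne_zero

lemma analyticOrderAt_theta_le_one {τ : ℂ} (hτ : 0 < τ.im) (z : ℂ) :
    analyticOrderAt (theta τ) z ≤ 1 := by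
  by_cases h : theta τ z = 0
  · obtain ⟨p, q, rfl⟩ := (theta_eq_zero_iff hτ z).mp h
    rw [analyticOrderAt_theta hτ]
  · rw [((differentiable_theta hτ).analyticAt z).analyticOrderAt_eq_zero.mpr h]
    exact zero_le

/-! ### Entire functions -/

/-- A gluing device: chosen germs `G z` that agree on punctured neighbourhoods form one analytic
function `w ↦ G w w`. -/
lemma analyticAt_diagonal {E : Type*} [NormedAddCommGroup E] [NormedSpace ℂ E] {G : ℂ → ℂ → E}
    (z : ℂ) (hG : AnalyticAt ℂ (G z) z) (h : ∀ᶠ w in 𝓝[≠] z, G w w = G z w) :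
    AnalyticAt ℂ (fun w => G w w) z ∧ (fun w => G w w) =ᶠ[𝓝 z] G z := by
  have e : (fun w => G w w) =ᶠ[𝓝 z] G z := by
    have h' := eventually_nhdsWithin_iff.mp h
    filter_upwards [h'] with w hw
    by_cases hwz : w = z
    · rw [hwz]
    · exact hw hwz
  exact ⟨hG.congr e.symm, e⟩

lemma analyticOrderAt_ne_top_of_entire {f : ℂ → ℂ} (hf : Differentiable ℂ f) (h : ∃ z, f z ≠ 0)
    (z : ℂ) : analyticOrderAt f z ≠ ⊤ := by
  obtain ⟨w, hw⟩ := h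
  intro ht
  rw [analyticOrderAt_eq_top] at ht
  have ha := Complex.analyticOnNhd_univ_iff_differentiable.mpr hf
  exact hw (ha.eqOn_zero_of_preconnected_of_eventuallyEq_zero isPreconnected_univ (Set.mem_univ z) ht (Set.mem_univ w))

lemma eventually_ne_zero_of_entire {f : ℂ → ℂ} (hf : Differentiable ℂ f) (h : ∃ z, f z ≠ 0)
    (z : ℂ) : ∀ᶠ w in 𝓝[≠] z, f w ≠ 0 := by
  rcases (hf.analyticAt z).eventually_eq_zero_or_eventually_ne_zero with h' | h'
  · exact absurd (analyticOrderAt_eq_top.mpr h') (analyticOrderAt_ne_top_of_entire hf h z)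
  · exact h'

/-- The order condition makes `f / g` analytic near each point; the local quotients agree off the
isolated zeros of `g` and therefore glue. -/
lemma exists_entire_quotient {f g : ℂ → ℂ} (hf : Differentiable ℂ f) (hg : Differentiable ℂ g)
    (hg0 : ∃ z, g z ≠ 0) (hle : ∀ z, analyticOrderAt g z ≤ analyticOrderAt f z) :
    ∃ h, Differentiable ℂ h ∧ ∀ z, f z = g z * h z := by
  have hloc : ∀ z, ∃ h, AnalyticAt ℂ h z ∧ ∀ᶠ w in 𝓝 z, f w = g w * h w := by
    intro z
    obtain ⟨k, hk⟩ := ENat.ne_top_iff_exists.mp (analyticOrderAt_ne_top_of_entire hg hg0 z)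
    obtain ⟨g₁, hg₁, hg₁0, eg⟩ := ((hg.analyticAt z).analyticOrderAt_eq_natCast).mp hk.symm
    have hk' := hle z
    rw [← hk, natCast_le_analyticOrderAt (hf.analyticAt z)] at hk'
    obtain ⟨f₁, hf₁, ef⟩ := hk'
    refine ⟨fun w => f₁ w / g₁ w, hf₁.div hg₁ hg₁0, ?_⟩
    filter_upwards [eg, ef, hg₁.continuousAt.eventually_ne hg₁0] with w h1 h2 h3
    rw [h1, h2, smul_eq_mul, smul_eq_mul]
    field_simp
  choose h han he using hloc
  refine ⟨fun w => h w w, fun z => ?_, fun z => (he z).self_of_nhds⟩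
  refine (analyticAt_diagonal z (han z) ?_).1.differentiableAt
  filter_upwards [eventually_ne_zero_of_entire hg hg0 z,
    (he z).filter_mono nhdsWithin_le_nhds] with w h1 h2
  exact mul_left_cancel₀ h1 ((he w).self_of_nhds.symm.trans h2)

lemma eq_of_mul_eq_mul_of_entire {p f g : ℂ → ℂ} (hp : Differentiable ℂ p) (hp0 : ∃ z, p z ≠ 0)
    (hf : Continuous f) (hg : Continuous g) (h : ∀ z, p z * f z = p z * g z) (z : ℂ) :
    f z = g z := by
  have h1 : ∀ᶠ w in 𝓝[≠] z, f w = g w := by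
    filter_upwards [eventually_ne_zero_of_entire hp hp0 z] with w hw
    exact mul_left_cancel₀ hw (h w)
  exact tendsto_nhds_unique_of_eventuallyEq (hf.continuousAt.tendsto.mono_left nhdsWithin_le_nhds)
    (hg.continuousAt.tendsto.mono_left nhdsWithin_le_nhds) h1

/-- A fundamental parallelogram of the lattice `ℤ + ℤτ`. -/
def parallelogram (τ : ℂ) : Set ℂ :=
  (fun x : ℝ × ℝ => (x.1 + x.2 * τ : ℂ)) '' (Set.Icc 0 1 ×ˢ Set.Icc 0 1)

lemma isCompact_parallelogram (τ : ℂ) : IsCompact (parallelogram τ) :=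
  (isCompact_Icc.prod isCompact_Icc).image (by fun_prop)

lemma exists_mem_parallelogram {τ : ℂ} (hτ : 0 < τ.im) (z : ℂ) :
    ∃ w ∈ parallelogram τ, ∃ p q : ℤ, z = w + (p + q * τ) := by
  set b : ℝ := z.im / τ.im with hb
  set a : ℝ := z.re - b * τ.re with ha
  refine ⟨_, ⟨(Int.fract a, Int.fract b), ⟨⟨Int.fract_nonneg _, (Int.fract_lt_one _).le⟩,
    ⟨Int.fract_nonneg _, (Int.fract_lt_one _).le⟩⟩, rfl⟩, ⌊a⌋, ⌊b⌋, ?_⟩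
  have e1 : ((Int.fract a : ℝ) : ℂ) + (⌊a⌋ : ℂ) = a := by exact_mod_cast Int.fract_add_floor a
  have e2 : ((Int.fract b : ℝ) : ℂ) + (⌊b⌋ : ℂ) = b := by exact_mod_cast Int.fract_add_floor b
  have e3 : z = a + b * τ := by
    apply Complex.ext
    · simp [ha]
    · simp [hb, hτ.ne']
  linear_combination e3 - e1 - τ * e2

lemma periodic_lattice {α : Type*} {τ : ℂ} {f : ℂ → α} (h1 : Function.Periodic f 1)
    (h2 : Function.Periodic f τ) (z : ℂ) (p q : ℤ) : f (z + (p + q * τ)) = f z := by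
  rw [← add_assoc, h2.int_mul, ← mul_one (p : ℂ), h1.int_mul]

lemma exists_bound_of_periodic {τ : ℂ} (hτ : 0 < τ.im) {f : ℂ → ℝ} (hf : Continuous f)
    (h1 : Function.Periodic f 1) (h2 : Function.Periodic f τ) : ∃ C, ∀ z, |f z| ≤ C := by
  obtain ⟨C, hC⟩ := (isCompact_parallelogram τ).exists_bound_of_continuousOn hf.continuousOn
  refine ⟨C, fun z => ?_⟩
  obtain ⟨w, hw, p, q, rfl⟩ := exists_mem_parallelogram hτ z
  rw [periodic_lattice h1 h2]
  exact hC w hw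

/-- A real exponential twist makes the norm of `h` doubly periodic, hence bounded, and Liouville's
theorem applies. The period `1` then forces the exponent to be an integer. -/
lemma eq_const_mul_ex_of_quasiperiodic {τ : ℂ} (hτ : 0 < τ.im) {κ : ℂ} (hκ : κ ≠ 0) {h : ℂ → ℂ}
    (hd : Differentiable ℂ h) (h1 : ∀ z, h (z + 1) = h z) (h2 : ∀ z, h (z + τ) = κ * h z)
    (h0 : ∃ z, h z ≠ 0) : ∃ (C : ℂ) (j : ℤ), C ≠ 0 ∧ κ = ex (j * τ) ∧ ∀ z, h z = C * ex (j * z) := by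
  -- Chosen so that `‖ex (y * τ)‖ = ‖κ‖⁻¹`; as `y` is real, `‖ex y‖ = 1`.
  set y : ℝ := Real.log ‖κ‖ / (2 * Real.pi * τ.im) with hy
  set k : ℂ → ℂ := fun z => ex (y * z) * h z with hk
  have hkd : Differentiable ℂ k := (differentiable_ex.comp (by fun_prop)).mul hd
  obtain ⟨B, hB⟩ := exists_bound_of_periodic hτ (f := fun z => ‖k z‖) hkd.continuous.norm
    (fun z => by simp [hk, h1, norm_ex]) (fun z => by
      have : (2 * Real.pi * τ.im) ≠ 0 := by positivity
      have e : Real.exp (-(2 * Real.pi * (y * τ.im))) = ‖κ‖⁻¹ := by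
        rw [show 2 * Real.pi * (y * τ.im) = Real.log ‖κ‖ by rw [hy]; field_simp, Real.exp_neg,
          Real.exp_log (norm_pos_iff.mpr hκ)]
      simp only [hk, h2, mul_add, ex_add, norm_mul, norm_ex (y * τ), 
        Complex.im_ofReal_mul, e]
      have : ‖κ‖ ≠ 0 := norm_ne_zero_iff.mpr hκ
      field_simp)
  have hbd : Bornology.IsBounded (Set.range k) := by
    rw [isBounded_iff_forall_norm_le]
    exact ⟨B, by rintro _ ⟨z, rfl⟩; exact (le_abs_self _).trans (hB z)⟩
  obtain ⟨C, hC⟩ := hkd.exists_const_forall_eq_of_bounded hbd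
  have hh : ∀ z, h z = C * ex (-(y * z)) := fun z => by
    rw [← hC z, ex_neg, hk]
    field_simp [ex_ne_zero]
  have hC0 : C ≠ 0 := by
    rintro rfl
    obtain ⟨z, hz⟩ := h0
    exact hz (by rw [hh, zero_mul])
  have e1 : ex (-(y : ℂ)) = 1 := by
    have := h1 0
    rw [hh, hh] at this
    simpa [hC0] using this
  obtain ⟨j, hj⟩ := ex_eq_one_iff.mp e1
  refine ⟨C, j, hC0, ?_, fun z => by rw [hh, ← neg_mul, hj]⟩
  have := h2 0
  rw [hh, hh] at this
  rw [← hj, neg_mul]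
  simp at this
  exact (mul_right_cancel₀ hC0 (by rw [← this]; ring)).symm

/-! ### Spaces of theta functions -/

/-- The entire functions `f` with `f (z + 1) = f z` and `f (z + τ) = c e(-kz) f z`. -/
def thetaSpace (τ c : ℂ) (k : ℕ) : Submodule ℂ (ℂ → ℂ) where
  carrier := {f | Differentiable ℂ f ∧ (∀ z, f (z + 1) = f z) ∧
    ∀ z, f (z + τ) = c * ex (-(k * z)) * f z}
  zero_mem' := ⟨differentiable_const 0, by simp, by simp⟩
  add_mem' := by
    rintro f g ⟨h1, h2, h3⟩ ⟨h1', h2', h3'⟩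
    exact ⟨h1.add h1', fun z => by simp [h2, h2'], fun z => by simp [h3, h3', mul_add]⟩
  smul_mem' := by
    rintro a f ⟨h1, h2, h3⟩
    exact ⟨h1.const_smul a, fun z => by simp [h2], fun z => by simp [h3]; ring⟩

/-- The zero `w` propagates to `w + ℤ + ℤτ`, where `theta τ (z - w)` has its only zeros, all simple,
so it divides `f`. The quotient inherits the quotient of the multipliers. -/
lemma exists_eq_theta_mul {τ : ℂ} (hτ : 0 < τ.im) {c : ℂ} (hc : c ≠ 0) {k : ℕ} {f : ℂ → ℂ}
    (hf : f ∈ thetaSpace τ c (k + 1)) {w : ℂ} (hw : f w = 0) :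
    ∃ h ∈ thetaSpace τ (-(c * ex (-w))) k, ∀ z, f z = theta τ (z - w) * h z := by
  obtain ⟨hd, h1, h2⟩ := hf
  have hθ : Differentiable ℂ fun z => theta τ (z - w) :=
    (differentiable_theta hτ).comp (by fun_prop)
  have hθ0 : ∃ z, theta τ (z - w) ≠ 0 := by
    -- The point `1/2` is not in `ℤ + ℤτ`.
    refine ⟨w + 1 / 2, ?_⟩
    rw [Ne, theta_eq_zero_iff hτ]
    rintro ⟨p, q, h⟩
    have him := congrArg Complex.im h
    simp [hτ.ne'] at him
    have hre := congrArg Complex.re h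
    simp [him] at hre
    have : (1 : ℝ) = 2 * p := by linarith
    norm_cast at this
    omega
  have hzero : ∀ p q : ℤ, f (w + (p + q * τ)) = 0 := by
    have a1 : Function.Periodic (fun z => f z = 0) 1 := fun z => by simp [h1]
    have a2 : Function.Periodic (fun z => f z = 0) τ := fun z => by
      simp [h2, ex_ne_zero, hc]
    intro p q
    have := (a2.int_mul q (w + p * 1)).trans (a1.int_mul p w)
    simpa [add_assoc, hw] using this
  obtain ⟨h, hhd, hh⟩ := exists_entire_quotient hd hθ hθ0 fun z => by
    have e : analyticOrderAt (fun z => theta τ (z - w)) z = analyticOrderAt (theta τ) (z - w) :=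
      analyticOrderAt_comp_of_deriv_ne_zero (f := theta τ) (g := fun z => z - w) (by fun_prop)
        (by simp)
    rw [e]
    by_cases h0 : theta τ (z - w) = 0
    · refine (analyticOrderAt_theta_le_one hτ _).trans ?_
      rw [Order.one_le_iff_ne_zero, (hd.analyticAt z).analyticOrderAt_ne_zero]
      obtain ⟨p, q, hpq⟩ := (theta_eq_zero_iff hτ _).mp h0
      rw [← hzero p q, ← hpq]
      congr 1; ring
    · rw [((differentiable_theta hτ).analyticAt _).analyticOrderAt_eq_zero.mpr h0]
      exact zero_le
  refine ⟨h, ⟨hhd, ?_, ?_⟩, hh⟩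
  · refine eq_of_mul_eq_mul_of_entire hθ hθ0 (hhd.continuous.comp (by fun_prop)) hhd.continuous
      fun z => ?_
    have := h1 z
    rw [hh, hh, show z + 1 - w = z - w + 1 by ring, theta_add_one] at this
    exact this
  · refine eq_of_mul_eq_mul_of_entire hθ hθ0 (hhd.continuous.comp (by fun_prop))
      (.mul (.mul continuous_const (differentiable_ex.continuous.comp (by fun_prop)))
        hhd.continuous) fun z => ?_
    have := h2 z
    rw [hh, hh, show z + τ - w = z - w + τ by ring, theta_add_tau hτ] at this
    have e1 : ex (-((k + 1 : ℕ) * z)) = ex (-(k * z)) * ex (-w) * ex (-(z - w)) := by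
      rw [← ex_add, ← ex_add]; congr 1; push_cast; ring
    rw [e1] at this
    apply mul_left_cancel₀ (ex_ne_zero (-(z - w)))
    linear_combination -this

/-- Induction on the weight: evaluation at a point costs one dimension, and its kernel is `theta`
times a space of weight one lower. -/
lemma rank_thetaSpace_le {τ : ℂ} (hτ : 0 < τ.im) {c : ℂ} (hc : c ≠ 0) (k : ℕ) :
    Module.rank ℂ (thetaSpace τ c (k + 1)) ≤ (k + 1 : ℕ) := by
  induction k generalizing c with
  | zero =>
    -- With `ex w = c`, a function vanishing at `w` leaves a quotient with multiplier `-1`. If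
    -- nonzero it would be `C * ex (j * z)` with `ex (j * τ) = -1`; norms force `j = 0`, a
    -- contradiction.
    obtain ⟨w, hw⟩ := exists_ex_eq hc
    let ev : thetaSpace τ c (0 + 1) →ₗ[ℂ] ℂ :=
      (LinearMap.proj w).comp (thetaSpace τ c (0 + 1)).subtype
    have hinj : Function.Injective ev := by
      rw [injective_iff_map_eq_zero]
      rintro ⟨f, hf⟩ (h0 : f w = 0)
      obtain ⟨h, ⟨hd, h1, h2⟩, hh⟩ := exists_eq_theta_mul hτ hc hf h0
      have hh0 : ∀ z, h z = 0 := by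
        by_contra! hne
        rw [ex_neg, hw, mul_inv_cancel₀ hc] at h2
        obtain ⟨C, j, hC, hj, -⟩ := eq_const_mul_ex_of_quasiperiodic hτ (κ := -1) (by simp) hd h1
          (fun z => by simpa using h2 z) hne
        have hn := congrArg norm hj
        rw [norm_ex, norm_neg, norm_one, eq_comm, Real.exp_eq_one_iff] at hn
        have : (j : ℝ) = 0 := by simpa [Real.pi_ne_zero, hτ.ne'] using hn
        norm_cast at this
        subst this
        norm_num at hj
      ext z
      simp [hh, hh0]
    have := LinearMap.rank_le_of_injective ev hinj
    simpa using this
  | succ k ih =>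
    set V := thetaSpace τ c (k + 1 + 1) with hV
    set W := thetaSpace τ (-(c * ex (-0))) (k + 1) with hW
    let ev : V →ₗ[ℂ] ℂ := (LinearMap.proj 0).comp V.subtype
    let mul : W →ₗ[ℂ] ℂ → ℂ := (LinearMap.mulLeft ℂ fun z => theta τ (z - 0)).comp W.subtype
    have hker : (LinearMap.ker ev).map V.subtype ≤ LinearMap.range mul := by
      rintro _ ⟨⟨f, hf⟩, (h0 : f 0 = 0), rfl⟩
      obtain ⟨h, hh, e⟩ := exists_eq_theta_mul hτ hc hf h0
      exact ⟨⟨h, hh⟩, funext fun z => (e z).symm⟩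
    have h1 : Module.rank ℂ (LinearMap.ker ev) ≤ (k + 1 : ℕ) := by
      rw [(Submodule.equivMapOfInjective V.subtype V.injective_subtype _).rank_eq]
      exact (Submodule.rank_mono hker).trans ((LinearMap.rank_le_domain mul).trans (ih (by simp [hc])))
    rw [← LinearMap.rank_range_add_rank_ker ev, add_comm]
    push_cast
    gcongr
    · exact_mod_cast h1
    · simpa using Submodule.rank_le (LinearMap.range ev)

/-! ### Global homogeneous coordinates -/

/-- Divide by the first period, and change the sign of the ratio if it lies in the lower half plane.
-/
lemma exists_lattice_normalForm (L : PeriodPair) : ∃ ω τ : ℂ, ω ≠ 0 ∧ 0 < τ.im ∧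
    ∀ z, z ∈ L.lattice ↔ ∃ p q : ℤ, z = ω * (p + q * τ) := by
  have hind := LinearIndependent.pair_iff.mp L.indep
  have hω : L.ω₁ ≠ 0 := by
    intro h
    have := (hind 1 0 (by simp [h])).1
    exact one_ne_zero this
  have him : (L.ω₂ / L.ω₁).im ≠ 0 := by
    intro h
    have e : L.ω₂ / L.ω₁ = ((L.ω₂ / L.ω₁).re : ℂ) := Complex.ext rfl (by simpa using h)
    have := (hind (-(L.ω₂ / L.ω₁).re) 1 (by
      rw [Complex.real_smul, Complex.real_smul, Complex.ofReal_neg, ← e]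
      field_simp
      simp)).2
    exact one_ne_zero this
  rcases him.lt_or_gt with h | h
  · refine ⟨L.ω₁, -(L.ω₂ / L.ω₁), hω, by simpa using h, fun z => ?_⟩
    rw [PeriodPair.mem_lattice]
    constructor
    · rintro ⟨p, q, rfl⟩
      exact ⟨p, -q, by push_cast; field_simp⟩
    · rintro ⟨p, q, rfl⟩
      exact ⟨p, -q, by push_cast; field_simp⟩
  · refine ⟨L.ω₁, L.ω₂ / L.ω₁, hω, h, fun z => ?_⟩
    rw [PeriodPair.mem_lattice]
    constructor
    · rintro ⟨p, q, rfl⟩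
      exact ⟨p, q, by field_simp⟩
    · rintro ⟨p, q, rfl⟩
      exact ⟨p, q, by field_simp⟩

lemma Torus.pt_eq_iff {L : PeriodPair} {z w : ℂ} : Torus.pt L z = Torus.pt L w ↔ z - w ∈ L.lattice :=
  Submodule.Quotient.eq _

/-- Homogeneous coordinates for the map `m` by theta functions in the coordinate `u = z / ω`, where
`ω (ℤ + ℤτ)` is the period lattice. -/
structure ThetaLift {n : ℕ} (m : NormalMap n) where
  /-- The scaling factor. -/
  ω : ℂ
  /-- The period ratio. -/
  τ : ℂ
  /-- The multiplier. -/
  c : ℂ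
  /-- The homogeneous coordinates. -/
  F : ℂ → Fin n → ℂ
  ω_ne_zero : ω ≠ 0
  τ_pos : 0 < τ.im
  c_ne_zero : c ≠ 0
  mem_lattice : ∀ z, z ∈ m.L.lattice ↔ ∃ p q : ℤ, z = ω * (p + q * τ)
  F_ne_zero : ∀ u, F u ≠ 0
  toFun_pt : ∀ u, m.toFun (Torus.pt m.L (ω * u)) = Projectivization.mk ℂ (F u) (F_ne_zero u)
  mem_thetaSpace : ∀ j, (fun u => F u j) ∈ thetaSpace τ c n

lemma exists_unit_of_analyticOrderAt_eq {f g : ℂ → ℂ} {z : ℂ} (hf : AnalyticAt ℂ f z)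
    (hg : AnalyticAt ℂ g z) {k : ℕ} (hfk : analyticOrderAt f z = k) (hgk : analyticOrderAt g z = k) :
    ∃ v, AnalyticAt ℂ v z ∧ v z ≠ 0 ∧ ∀ᶠ w in 𝓝 z, f w = v w * g w := by
  obtain ⟨f₁, hf₁, hf₁0, ef⟩ := hf.analyticOrderAt_eq_natCast.mp hfk
  obtain ⟨g₁, hg₁, hg₁0, eg⟩ := hg.analyticOrderAt_eq_natCast.mp hgk
  refine ⟨fun w => f₁ w / g₁ w, hf₁.div hg₁ hg₁0, div_ne_zero hf₁0 hg₁0, ?_⟩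
  filter_upwards [ef, eg, hg₁.continuousAt.eventually_ne hg₁0] with w h1 h2 h3
  rw [h1, h2, smul_eq_mul, smul_eq_mul]
  field_simp

/-- A theta function with the given zeros. -/
lemma exists_theta_with_divisor {L : PeriodPair} {ω τ : ℂ} (hω : ω ≠ 0) (hτ : 0 < τ.im)
    (hL : ∀ z, z ∈ L.lattice ↔ ∃ p q : ℤ, z = ω * (p + q * τ)) (D : Torus L →₀ ℕ) :
    ∃ (c : ℂ) (Θ : ℂ → ℂ), c ≠ 0 ∧ Θ ∈ thetaSpace τ c D.degree ∧
      ∀ u, analyticOrderAt Θ u = (D (Torus.pt L (ω * u)) : ℕ∞) := by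
  have hsurj : ∀ Q : Torus L, ∃ s : ℂ, Torus.pt L (ω * s) = Q := fun Q => by
    obtain ⟨z, rfl⟩ := Submodule.Quotient.mk_surjective _ Q
    exact ⟨z / ω, by rw [mul_div_cancel₀ _ hω]⟩
  choose s hs using hsurj
  induction D using Finsupp.induction_linear with
  | zero =>
    refine ⟨1, fun _ => 1, one_ne_zero, ⟨differentiable_const 1, by simp, by simp⟩, fun u => ?_⟩
    rw [analyticAt_const.analyticOrderAt_eq_zero.mpr one_ne_zero]
    simp
  | add D D' h h' =>
    obtain ⟨c, Θ, hc, ⟨h1, h2, h3⟩, ho⟩ := h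
    obtain ⟨c', Θ', hc', ⟨h1', h2', h3'⟩, ho'⟩ := h'
    refine ⟨c * c', Θ * Θ', mul_ne_zero hc hc', ⟨h1.mul h1', fun z => by simp [h2, h2'],
      fun z => ?_⟩, fun u => ?_⟩
    · rw [Pi.mul_apply, h3, h3', map_add, Nat.cast_add, add_mul, neg_add, ex_add, Pi.mul_apply]
      ring
    · rw [analyticOrderAt_mul (h1.analyticAt u) (h1'.analyticAt u), ho, ho', Finsupp.add_apply]
      simp
  | single Q k =>
    have hd : Differentiable ℂ fun u => theta τ (u - s Q) :=
      (differentiable_theta hτ).comp (by fun_prop)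
    refine ⟨(-ex (s Q)) ^ k, (fun u => theta τ (u - s Q)) ^ k,
      pow_ne_zero _ (neg_ne_zero.mpr (ex_ne_zero _)), ⟨hd.pow k, fun z => ?_, fun z => ?_⟩,
      fun u => ?_⟩
    · rw [Pi.pow_apply, Pi.pow_apply, show z + 1 - s Q = z - s Q + 1 by ring, theta_add_one]
    · rw [Pi.pow_apply, Pi.pow_apply, show z + τ - s Q = z - s Q + τ by ring, theta_add_tau hτ,
        Finsupp.degree_single, ← mul_neg, ex_nsmul, ← mul_pow, ← mul_pow, neg_sub, ex_sub, ex_neg]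
      ring
    · have e : analyticOrderAt (fun u => theta τ (u - s Q)) u = analyticOrderAt (theta τ) (u - s Q) :=
        analyticOrderAt_comp_of_deriv_ne_zero (f := theta τ) (g := fun z => z - s Q) (by fun_prop)
          (by simp)
      rw [analyticOrderAt_pow (hd.analyticAt u), e, nsmul_eq_mul]
      have hiff : theta τ (u - s Q) = 0 ↔ Q = Torus.pt L (ω * u) := by
        rw [theta_eq_zero_iff hτ, eq_comm, ← hs Q, Torus.pt_eq_iff, hL, hs Q]
        refine exists₂_congr fun p q => ?_
        rw [← mul_sub, mul_right_inj' hω]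
      by_cases h0 : theta τ (u - s Q) = 0
      · obtain ⟨p, q, hpq⟩ := (theta_eq_zero_iff hτ _).mp h0
        rw [hpq, analyticOrderAt_theta hτ, hiff.mp h0, Finsupp.single_eq_same, mul_one]
      · rw [((differentiable_theta hτ).analyticAt _).analyticOrderAt_eq_zero.mpr h0, mul_zero,
          Finsupp.single_eq_of_ne (fun h => h0 (hiff.mpr h.symm))]
        rfl

lemma analyticAt_dotProduct {n : ℕ} (a : Fin n → ℂ) {F : ℂ → Fin n → ℂ} {z : ℂ}
    (hF : AnalyticAt ℂ F z) : AnalyticAt ℂ (fun w => a ⬝ᵥ F w) z := by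
  have : AnalyticAt ℂ (fun w => ∑ i, a i * F w i) z :=
    Finset.analyticAt_fun_sum _ fun i _ => analyticAt_const.mul ((analyticAt_pi_iff.mp hF) i)
  exact this

/-- Fix a hyperplane `a` and a theta function `Θ` with the divisor that it cuts out. Normalized by
`a ⬝ᵥ F = Θ`, a local lift is unique where `Θ ≠ 0`; so the normalized lifts glue to an entire
vector, which inherits the multipliers of `Θ`. -/
theorem NormalMap.nonempty_thetaLift {n : ℕ} (hn : n ≠ 0) (m : NormalMap n) :
    Nonempty (ThetaLift m) := by
  obtain ⟨ω, τ, hω, hτ, hL⟩ := exists_lattice_normalForm m.L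
  obtain ⟨a, ha⟩ : ∃ a : Fin n → ℂ, a ≠ 0 :=
    ⟨fun _ => 1, fun h => one_ne_zero (congrFun h ⟨0, Nat.pos_of_ne_zero hn⟩)⟩
  obtain ⟨D, hD, hdeg⟩ := m.degree_eq a ha
  obtain ⟨c, Θ, hc, hΘ, ho⟩ := exists_theta_with_divisor hω hτ hL D
  rw [hdeg] at hΘ
  obtain ⟨hΘd, hΘ1, hΘτ⟩ := hΘ
  have hΘ0 : ∃ z, Θ z ≠ 0 := by
    by_contra! h
    have h0 := ho 0
    rw [analyticOrderAt_eq_top.mpr (.of_forall h)] at h0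
    exact absurd h0 (ENat.top_ne_natCast _)
  set f : ℂ → ℙ ℂ (Fin n → ℂ) := fun u => m.toFun (Torus.pt m.L (ω * u)) with hf
  have hloc : ∀ z, ∃ G : ℂ → Fin n → ℂ, AnalyticAt ℂ G z ∧
      ∀ᶠ u in 𝓝 z, a ⬝ᵥ G u = Θ u ∧ ∃ h : G u ≠ 0, f u = Projectivization.mk ℂ (G u) h := by
    intro z
    obtain ⟨F, hF⟩ := m.holomorphic (ω * z)
    have hg : AnalyticAt ℂ (fun u : ℂ => ω * u) z := by fun_prop
    have hFω : AnalyticAt ℂ (fun u => F (ω * u)) z := hF.1.comp_of_eq hg rfl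
    have hord : analyticOrderAt (fun u => a ⬝ᵥ F (ω * u)) z = D (Torus.pt m.L (ω * z)) := by
      rw [← hD _ _ hF]
      exact analyticOrderAt_comp_of_deriv_ne_zero (f := fun w => a ⬝ᵥ F w) hg (by
        rw [deriv_const_mul_field]; simpa using hω)
    -- `Θ` and `a ⬝ᵥ F` have the same order at `z`, so they differ by a unit `v`, and `v • F` is the
    -- normalized lift.
    obtain ⟨v, hv, hv0, he⟩ := exists_unit_of_analyticOrderAt_eq (hΘd.analyticAt z)
      (analyticAt_dotProduct a hFω) (ho z) hord
    refine ⟨fun u => v u • F (ω * u), hv.smul hFω, ?_⟩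
    have ht : Filter.Tendsto (fun u : ℂ => ω * u) (𝓝 z) (𝓝 (ω * z)) := hg.continuousAt
    filter_upwards [he, hv.continuousAt.eventually_ne hv0, ht.eventually hF.2] with u h1 h2 h3
    obtain ⟨h3, h4⟩ := h3
    refine ⟨by rw [dotProduct_smul, h1, smul_eq_mul], smul_ne_zero h2 h3, ?_⟩
    rw [hf]
    simp only
    rw [h4, Projectivization.mk_eq_mk_iff']
    exact ⟨(v u)⁻¹, by rw [smul_smul, inv_mul_cancel₀ h2, one_smul]⟩
  choose G hG hGe using hloc
  have hGs := fun z => (hGe z).self_of_nhds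
  have hprop : ∀ {x y : Fin n → ℂ} (hx : x ≠ 0) (hy : y ≠ 0),
      Projectivization.mk ℂ x hx = Projectivization.mk ℂ y hy → (a ⬝ᵥ y) • x = (a ⬝ᵥ x) • y := by
    intro x y hx hy h
    obtain ⟨t, rfl⟩ := (Projectivization.mk_eq_mk_iff' ℂ x y hx hy).mp h
    rw [dotProduct_smul, smul_eq_mul, smul_smul, mul_comm]
  have hF : Differentiable ℂ fun u => G u u := fun z => by
    refine (analyticAt_diagonal z (hG z) ?_).1.differentiableAt
    filter_upwards [eventually_ne_zero_of_entire hΘd hΘ0 z,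
      (hGe z).filter_mono nhdsWithin_le_nhds] with w h1 ⟨h2, h3, h4⟩
    obtain ⟨h2', h3', h4'⟩ := hGs w
    have := hprop h3' h3 (h4'.symm.trans h4)
    rw [h2, h2'] at this
    exact smul_right_injective _ h1 this
  have hFj : ∀ j, Differentiable ℂ fun u => G u u j := fun j => differentiable_pi.mp hF j
  -- Parameters of the same point give proportional vectors, and the normalization identifies the
  -- ratio as `Θ w / Θ u`, written here without division.
  have hshift : ∀ u w, Torus.pt m.L (ω * w) = Torus.pt m.L (ω * u) →
      ∀ j, Θ u * G w w j = Θ w * G u u j := by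
    intro u w h j
    obtain ⟨h2, h3, h4⟩ := hGs u
    obtain ⟨h2', h3', h4'⟩ := hGs w
    have e : f w = f u := by rw [hf]; simp only; rw [h]
    have := congrFun (hprop h3' h3 (h4'.symm.trans (e.trans h4))) j
    rwa [h2, h2'] at this
  refine ⟨⟨ω, τ, c, fun u => G u u, hω, hτ, hc, hL, fun u => (hGs u).2.1, fun u => (hGs u).2.2,
    fun j => ⟨hFj j, ?_, ?_⟩⟩⟩
  · refine eq_of_mul_eq_mul_of_entire hΘd hΘ0 ((hFj j).continuous.comp (by fun_prop))
      (hFj j).continuous fun u => ?_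
    rw [hshift u (u + 1) (by
      rw [Torus.pt_eq_iff, hL]; exact ⟨1, 0, by push_cast; ring⟩) j, hΘ1]
  · refine eq_of_mul_eq_mul_of_entire hΘd hΘ0 ((hFj j).continuous.comp (by fun_prop))
      (.mul (.mul continuous_const (differentiable_ex.continuous.comp (by fun_prop)))
        (hFj j).continuous) fun u => ?_
    rw [hshift u (u + τ) (by
      rw [Torus.pt_eq_iff, hL]; exact ⟨0, 1, by push_cast; ring⟩) j, hΘτ]
    ring

/-! ### Forms invariant under a Heisenberg pair -/

section linearAlgebra

variable {n : ℕ}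

lemma mul_zeta_pow {A B : Matrix (Fin n) (Fin n) ℂ} {ζ : ℂ} (h : B * A = ζ • (A * B)) (k : ℕ) :
    B ^ k * A = ζ ^ k • (A * B ^ k) := by
  induction k with
  | zero => simp
  | succ k ih =>
    rw [pow_succ, Matrix.mul_assoc, h, Matrix.mul_smul, ← Matrix.mul_assoc, ih, Matrix.smul_mul,
      smul_smul, Matrix.mul_assoc, ← pow_succ', ← pow_succ]

/-- A basis of eigenvectors for `A` which is permuted by `B`. -/
lemma exists_heisenberg_basis (hn : n ≠ 0) {A B : Matrix (Fin n) (Fin n) ℂ} (hA : A.det = 1)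
    (hB : B.det = 1) {ζ : ℂ} (hζ : IsPrimitiveRoot ζ n) (h : B * A = ζ • (A * B)) :
    ∃ (V : Matrix (Fin n) (Fin n) ℂ) (ev : Fin n → ℂ), IsUnit V.det ∧ Function.Injective ev ∧
      (∀ k, ‖ev k‖ = 1) ∧ (∀ k, A *ᵥ V.col k = ev k • V.col k) ∧
      (∀ k : Fin n, V.col k = B ^ (k : ℕ) *ᵥ V.col ⟨0, Nat.pos_of_ne_zero hn⟩) ∧
      (∃ α : ℂ, ‖α‖ = 1 ∧ A ^ n = α • 1) ∧ ∃ β : ℂ, ‖β‖ = 1 ∧ B ^ n = β • 1 := by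
  have : Nonempty (Fin n) := ⟨⟨0, Nat.pos_of_ne_zero hn⟩⟩
  have hζ0 : ζ ≠ 0 := hζ.ne_zero hn
  have hζ1 : ‖ζ‖ = 1 := hζ.norm'_eq_one hn
  obtain ⟨l, hl⟩ := Module.End.exists_eigenvalue (Matrix.mulVecLin A)
  obtain ⟨v, hv⟩ := hl.exists_hasEigenvector
  have hv0 : v ≠ 0 := hv.2
  have hAv : A *ᵥ v = l • v := hv.apply_eq_smul
  have hl0 : l ≠ 0 := by
    rintro rfl
    have : ∃ v ≠ 0, A *ᵥ v = 0 := ⟨v, hv0, by rw [hAv, zero_smul]⟩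
    rw [Matrix.exists_mulVec_eq_zero_iff, hA] at this
    exact one_ne_zero this
  -- Moving `A` past `B ^ k` divides the eigenvalue by `ζ ^ k`; for `k < n` these eigenvalues are
  -- distinct since `ζ` is primitive.
  have hev : ∀ k : ℕ, A *ᵥ (B ^ k *ᵥ v) = (l * (ζ ^ k)⁻¹) • (B ^ k *ᵥ v) := fun k => by
    have e := congrArg (fun X => X *ᵥ v) (mul_zeta_pow h k)
    simp only [← Matrix.mulVec_mulVec, Matrix.smul_mulVec, hAv, Matrix.mulVec_smul] at e
    rw [mul_comm, mul_smul, e, smul_smul, inv_mul_cancel₀ (pow_ne_zero _ hζ0), one_smul]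
  have hinjB : ∀ k : ℕ, B ^ k *ᵥ v ≠ 0 := fun k h0 => by
    have : ∃ v ≠ 0, B ^ k *ᵥ v = 0 := ⟨v, hv0, h0⟩
    rw [Matrix.exists_mulVec_eq_zero_iff, Matrix.det_pow, hB, one_pow] at this
    exact one_ne_zero this
  set ev : Fin n → ℂ := fun k => l * (ζ ^ (k : ℕ))⁻¹ with hevd
  have hevinj : Function.Injective ev := fun j k hjk =>
    Fin.ext (hζ.pow_inj j.2 k.2 (inv_injective (mul_left_cancel₀ hl0 hjk)))
  set V : Matrix (Fin n) (Fin n) ℂ := Matrix.of fun i k => (B ^ (k : ℕ) *ᵥ v) i with hV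
  have hcol : ∀ k : Fin n, V.col k = B ^ (k : ℕ) *ᵥ v := fun k => rfl
  have hli : LinearIndependent ℂ V.col := by
    refine Module.End.eigenvectors_linearIndependent' (Matrix.mulVecLin A) ev hevinj V.col
      fun k => ⟨?_, hinjB k⟩
    rw [Module.End.mem_eigenspace_iff]
    exact hev k
  have hdet : IsUnit V.det := by
    rw [← Matrix.isUnit_iff_isUnit_det]
    exact Matrix.linearIndependent_cols_iff_isUnit.mp hli
  have hscal : ∀ (X : Matrix (Fin n) (Fin n) ℂ) (α : ℂ), X.det = 1 →
      (∀ k, X *ᵥ V.col k = α • V.col k) → ‖α‖ = 1 ∧ X = α • 1 := by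
    intro X α hX hXV
    have e : X * V = (α • 1) * V := by
      rw [Matrix.smul_mul, Matrix.one_mul]
      ext i k
      exact congrFun (hXV k) i
    have e' : X = α • 1 := ((Matrix.isUnit_iff_isUnit_det V).mpr hdet).mul_right_cancel e
    refine ⟨?_, e'⟩
    rw [e', Matrix.det_smul, Matrix.det_one, mul_one, Fintype.card_fin] at hX
    exact Complex.norm_eq_one_of_pow_eq_one hX hn
  have hAn : ‖l ^ n‖ = 1 ∧ A ^ n = (l ^ n) • 1 := by
    refine hscal _ _ (by rw [Matrix.det_pow, hA, one_pow]) fun k => ?_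
    have : ∀ j : ℕ, A ^ j *ᵥ V.col k = ev k ^ j • V.col k := fun j => by
      induction j with
      | zero => simp
      | succ j ih =>
        rw [pow_succ, ← Matrix.mulVec_mulVec, hcol, hev, Matrix.mulVec_smul, ← hcol, ih, smul_smul,
          pow_succ, mul_comm]
    rw [this, hevd]
    simp only
    rw [mul_pow, inv_pow, ← pow_mul, mul_comm (k : ℕ), pow_mul, hζ.pow_eq_one, one_pow, inv_one,
      mul_one]
  have hl1 : ‖l‖ = 1 := (pow_eq_one_iff_of_nonneg (norm_nonneg l) hn).mp (norm_pow l n ▸ hAn.1)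
  -- As `ζ ^ n = 1`, the vector `B ^ n v` lies in the `l`-eigenspace of `A`, which is the line
  -- through `v`. Since `B ^ n` commutes with `B`, it acts by the same scalar on the whole basis.
  have hBn : ∃ β : ℂ, ‖β‖ = 1 ∧ B ^ n = β • 1 := by
    set x := V⁻¹ *ᵥ (B ^ n *ᵥ v) with hx
    have hVx : V *ᵥ x = B ^ n *ᵥ v := by
      rw [hx, Matrix.mulVec_mulVec, Matrix.mul_nonsing_inv _ hdet, Matrix.one_mulVec]
    have hAV : A * V = V * Matrix.diagonal ev := by
      ext i k
      rw [Matrix.mul_diagonal, mul_comm]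
      exact congrFun (hev k) i
    have hx' : Matrix.diagonal ev *ᵥ x = l • x := by
      have hinj : Function.Injective V.mulVec := Matrix.mulVec_injective_of_isUnit
        ((Matrix.isUnit_iff_isUnit_det _).mpr hdet)
      apply hinj
      simp only [Matrix.mulVec_mulVec, ← hAV, Matrix.mulVec_smul]
      rw [← Matrix.mulVec_mulVec, hVx, hev, hζ.pow_eq_one, inv_one, mul_one]
    have hxk : ∀ k, k ≠ ⟨0, Nat.pos_of_ne_zero hn⟩ → x k = 0 := fun k hk => by
      have := congrFun hx' k
      rw [Matrix.mulVec_diagonal, Pi.smul_apply, smul_eq_mul] at this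
      by_contra hne
      have e := mul_right_cancel₀ hne this
      apply hk
      apply hevinj
      rw [e, hevd]
      simp
    have hBv : B ^ n *ᵥ v = x ⟨0, Nat.pos_of_ne_zero hn⟩ • v := by
      rw [← hVx, Matrix.mulVec_eq_sum, Finset.sum_eq_single ⟨0, Nat.pos_of_ne_zero hn⟩]
      · ext i
        simp [hV, mul_comm]
      · intro k _ hk
        simp [hxk k hk]
      · simp
    refine ⟨x ⟨0, Nat.pos_of_ne_zero hn⟩, hscal _ _ (by rw [Matrix.det_pow, hB, one_pow])
      fun k => ?_⟩
    rw [hcol, Matrix.mulVec_mulVec, ← pow_add, add_comm, pow_add, ← Matrix.mulVec_mulVec, hBv,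
      Matrix.mulVec_smul]
  refine ⟨V, ev, hdet, hevinj, fun k => ?_, fun k => hev k, fun k => ?_, ⟨_, hAn⟩, hBn⟩
  · rw [hevd]
    simp [hl1, hζ1]
  · rw [hcol, hcol]
    simp

lemma conjTranspose_mul_mul_apply (V M : Matrix (Fin n) (Fin n) ℂ) (j k : Fin n) :
    (Vᴴ * M * V) j k = star (V.col j) ⬝ᵥ (M *ᵥ V.col k) := by
  rw [Matrix.mul_assoc]
  rfl

lemma star_dotProduct_of_invariant {A M : Matrix (Fin n) (Fin n) ℂ} (h : Aᴴ * M * A = M)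
    (x y : Fin n → ℂ) : star (A *ᵥ x) ⬝ᵥ (M *ᵥ (A *ᵥ y)) = star x ⬝ᵥ (M *ᵥ y) := by
  conv_rhs => rw [← h]
  rw [Matrix.star_mulVec, ← Matrix.dotProduct_mulVec, Matrix.mulVec_mulVec, Matrix.mulVec_mulVec,
    Matrix.mul_assoc]

/-- The products `A ^ j * B ^ k` with `j, k < n` are closed under right multiplication by `A` and
`B` up to scalars of norm one, which do not affect `Xᴴ X`; so the sum of these forms is invariant.
Conversely, in the basis of `exists_heisenberg_basis` every invariant form is a positive multiple of
the identity. -/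
theorem exists_unique_invariant_form (hn : n ≠ 0) {A B : Matrix (Fin n) (Fin n) ℂ} (hA : A.det = 1)
    (hB : B.det = 1) {ζ : ℂ} (hζ : IsPrimitiveRoot ζ n) (h : B * A = ζ • (A * B)) :
    (∃ M : Matrix (Fin n) (Fin n) ℂ, M.PosDef ∧ Aᴴ * M * A = M ∧ Bᴴ * M * B = M) ∧
    ∀ M N : Matrix (Fin n) (Fin n) ℂ, M.PosDef → Aᴴ * M * A = M → Bᴴ * M * B = M →
      N.PosDef → Aᴴ * N * A = N → Bᴴ * N * B = N → ∃ c : ℝ, 0 < c ∧ N = c • M := by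
  obtain ⟨V, ev, hV, hinj, hnorm, hAV, hBV, ⟨α, hα, hAn⟩, β, hβ, hBn⟩ :=
    exists_heisenberg_basis hn hA hB hζ h
  have hζ1 : ‖ζ‖ = 1 := hζ.norm'_eq_one hn
  have hunit : ∀ (s : ℂ) (X : Matrix (Fin n) (Fin n) ℂ), ‖s‖ = 1 → (s • X)ᴴ * (s • X) = Xᴴ * X := by
    intro s X hs
    have : star s * s = 1 := by
      rw [Complex.star_def, ← Complex.normSq_eq_conj_mul_self, Complex.normSq_eq_norm_sq, hs]
      simp
    rw [Matrix.conjTranspose_smul, Matrix.smul_mul, Matrix.mul_smul, smul_smul, this, one_smul]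
  constructor
  · set K : ℕ → ℕ → Matrix (Fin n) (Fin n) ℂ := fun j k => (A ^ j * B ^ k)ᴴ * (A ^ j * B ^ k) with hK
    refine ⟨∑ j ∈ Finset.range n, ∑ k ∈ Finset.range n, K j k, ?_, ?_, ?_⟩
    · have hne : (Finset.range n).Nonempty := Finset.nonempty_range_iff.mpr hn
      refine Finset.sum_induction_nonempty _ _ (fun _ _ h h' => h.add h') hne fun j _ =>
        Finset.sum_induction_nonempty _ _ (fun _ _ h h' => h.add h') hne fun k _ => ?_
      apply Matrix.PosDef.conjTranspose_mul_self
      apply Matrix.mulVec_injective_of_isUnit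
      rw [Matrix.isUnit_iff_isUnit_det, Matrix.det_mul, Matrix.det_pow, Matrix.det_pow, hA, hB]
      simp
    · have e : ∀ j k, Aᴴ * K j k * A = K (j + 1) k := fun j k => by
        have : A ^ j * B ^ k * A = ζ ^ k • (A ^ (j + 1) * B ^ k) := by
          rw [Matrix.mul_assoc, mul_zeta_pow h, Matrix.mul_smul, ← Matrix.mul_assoc, ← pow_succ]
        rw [hK]
        simp only
        rw [← hunit (ζ ^ k) (A ^ (j + 1) * B ^ k) (by rw [norm_pow, hζ1, one_pow]), ← this,
          Matrix.conjTranspose_mul (A ^ j * B ^ k)]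
        simp only [Matrix.mul_assoc]
      have e' : ∀ k, K n k = K 0 k := fun k => by
        rw [hK]
        simp only
        rw [hAn, Matrix.smul_mul, hunit _ _ hα, pow_zero]
      simp only [Finset.mul_sum, Finset.sum_mul, e]
      -- Multiplication by `A` shifts the summation index by one, and the term at `n` equals the
      -- term at `0`.
      have := Finset.sum_range_succ' (fun j => ∑ k ∈ Finset.range n, K j k) n
      rw [Finset.sum_range_succ] at this
      simp only [e'] at this
      exact (add_right_cancel this).symm
    · have e : ∀ j k, Bᴴ * K j k * B = K j (k + 1) := fun j k => by
        rw [hK]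
        simp only
        rw [pow_succ, ← Matrix.mul_assoc (A ^ j), Matrix.conjTranspose_mul (A ^ j * B ^ k)]
        simp only [Matrix.mul_assoc]
      have e' : ∀ j, K j n = K j 0 := fun j => by
        rw [hK]
        simp only
        rw [hBn, Matrix.mul_smul, hunit _ _ hβ, pow_zero]
      simp only [Finset.mul_sum, Finset.sum_mul, e]
      refine Finset.sum_congr rfl fun j _ => ?_
      have := Finset.sum_range_succ' (fun k => K j k) n
      rw [Finset.sum_range_succ, e'] at this
      exact (add_right_cancel this).symm
  · have key : ∀ M : Matrix (Fin n) (Fin n) ℂ, M.PosDef → Aᴴ * M * A = M → Bᴴ * M * B = M →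
        ∃ c : ℝ, 0 < c ∧ Vᴴ * M * V = c • (1 : Matrix (Fin n) (Fin n) ℂ) := by
      intro M hM hMA hMB
      set i0 : Fin n := ⟨0, Nat.pos_of_ne_zero hn⟩
      have hV0 : V.col i0 ≠ 0 := by
        refine (Matrix.linearIndependent_cols_iff_isUnit.mpr ?_).ne_zero i0
        exact (Matrix.isUnit_iff_isUnit_det _).mpr hV
      have hpos := hM.dotProduct_mulVec_pos hV0
      obtain ⟨c, hc, hce⟩ : ∃ c : ℝ, 0 < c ∧ star (V.col i0) ⬝ᵥ (M *ᵥ V.col i0) = c := by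
        rw [Complex.pos_iff] at hpos
        exact ⟨_, hpos.1, Complex.ext rfl hpos.2.symm⟩
      refine ⟨c, hc, ?_⟩
      ext j k
      rw [conjTranspose_mul_mul_apply]
      by_cases hjk : j = k
      · subst hjk
        have : ∀ r : ℕ, star (B ^ r *ᵥ V.col i0) ⬝ᵥ (M *ᵥ (B ^ r *ᵥ V.col i0)) = c := fun r => by
          induction r with
          | zero => simpa using hce
          | succ r ih =>
            rw [pow_succ', ← Matrix.mulVec_mulVec, star_dotProduct_of_invariant hMB, ih]
        rw [hBV, this]
        simp
      -- A nonzero pairing of two eigenvectors would force `star (ev j) * ev k = 1 = star (ev j) *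
      -- ev j`, against the distinctness of the eigenvalues.
      · have e := star_dotProduct_of_invariant hMA (V.col j) (V.col k)
        rw [hAV, hAV, star_smul, Matrix.mulVec_smul, smul_dotProduct, dotProduct_smul] at e
        simp only [smul_eq_mul] at e
        rw [Matrix.smul_apply, Matrix.one_apply_ne hjk, smul_zero]
        by_contra hne
        have e1 : star (ev j) * ev k = 1 := mul_right_cancel₀ hne (by rw [one_mul, mul_assoc, e])
        have e2 : star (ev j) * ev j = 1 := by
          rw [Complex.star_def, ← Complex.normSq_eq_conj_mul_self, Complex.normSq_eq_norm_sq,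
            hnorm]
          simp
        have h0 : star (ev j) ≠ 0 := left_ne_zero_of_mul_eq_one e1
        exact hjk (hinj (mul_left_cancel₀ h0 (e2.trans e1.symm)))
    intro M N hM hMA hMB hN hNA hNB
    obtain ⟨c, hc, hMc⟩ := key M hM hMA hMB
    obtain ⟨d, hd, hNd⟩ := key N hN hNA hNB
    refine ⟨d / c, div_pos hd hc, ?_⟩
    have e : Vᴴ * N * V = Vᴴ * ((d / c) • M) * V := by
      rw [Matrix.mul_smul, Matrix.smul_mul, hMc, hNd, smul_smul, div_mul_cancel₀ _ hc.ne']
    have hu : IsUnit V := (Matrix.isUnit_iff_isUnit_det _).mpr hV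
    have hu' : IsUnit Vᴴ := by
      rw [Matrix.isUnit_iff_isUnit_det, Matrix.det_conjTranspose]
      exact hV.star
    exact hu'.mul_left_cancel (hu.mul_right_cancel e)

end linearAlgebra

/-! ### The Heisenberg group in theta coordinates -/

namespace ThetaLift

variable {n : ℕ} {m : NormalMap n} (X : ThetaLift m)

lemma differentiable_F : Differentiable ℂ X.F :=
  differentiable_pi.mpr fun j => (X.mem_thetaSpace j).1

lemma exists_pt_eq (P : Torus m.L) : ∃ u, Torus.pt m.L (X.ω * u) = P := by
  obtain ⟨z, rfl⟩ := Submodule.Quotient.mk_surjective _ P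
  exact ⟨z / X.ω, by rw [mul_div_cancel₀ _ X.ω_ne_zero]⟩

lemma pt_eq_iff {u w : ℂ} : Torus.pt m.L (X.ω * u) = Torus.pt m.L (X.ω * w) ↔
    ∃ p q : ℤ, u = w + (p + q * X.τ) := by
  rw [Torus.pt_eq_iff, X.mem_lattice]
  refine exists₂_congr fun p q => ?_
  rw [← mul_sub, mul_right_inj' X.ω_ne_zero, sub_eq_iff_eq_add']

lemma exists_dotProduct_ne_zero {a : Fin n → ℂ} (ha : a ≠ 0) : ∃ u, a ⬝ᵥ X.F u ≠ 0 := by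
  obtain ⟨P, hP⟩ := m.nondegenerate a ha
  obtain ⟨u, rfl⟩ := X.exists_pt_eq P
  exact ⟨u, by rwa [X.toFun_pt, dotProduct_rep_ne_zero_iff] at hP⟩

lemma eq_zero_of_dotProduct {a : Fin n → ℂ} (h : ∀ u, a ⬝ᵥ X.F u = 0) : a = 0 := by
  by_contra ha
  obtain ⟨u, hu⟩ := X.exists_dotProduct_ne_zero ha
  exact hu (h u)

/-- By nondegeneracy the vectors `F u` span, so identities between matrices can be tested on them.
-/
lemma matrix_ext {A B : Matrix (Fin n) (Fin n) ℂ} (h : ∀ u, A *ᵥ X.F u = B *ᵥ X.F u) : A = B := by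
  ext i j
  have : A i - B i = 0 := X.eq_zero_of_dotProduct fun u => by
    rw [sub_dotProduct, sub_eq_zero]
    exact congrFun (h u) i
  exact congrFun (sub_eq_zero.mp this) j

lemma dotProduct_mem (a : Fin n → ℂ) : (fun u => a ⬝ᵥ X.F u) ∈ thetaSpace X.τ X.c n := by
  have : (fun u => a ⬝ᵥ X.F u) = ∑ j, a j • fun u => X.F u j := by
    ext u
    simp [dotProduct]
  rw [this]
  exact Submodule.sum_mem _ fun j _ => Submodule.smul_mem _ _ (X.mem_thetaSpace j)

/-- The `n` coordinates are independent in a space of dimension at most `n`, hence a basis: the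
linear system is complete. -/
lemma exists_eq_dotProduct (hn : n ≠ 0) {f : ℂ → ℂ} (hf : f ∈ thetaSpace X.τ X.c n) :
    ∃ a : Fin n → ℂ, ∀ u, f u = a ⬝ᵥ X.F u := by
  let l : (Fin n → ℂ) →ₗ[ℂ] thetaSpace X.τ X.c n :=
    { toFun := fun a => ⟨fun u => a ⬝ᵥ X.F u, X.dotProduct_mem a⟩
      map_add' := fun a b => by ext u; simp [add_dotProduct]
      map_smul' := fun t a => by ext u; simp }
  have hl : Function.Injective l := by
    rw [injective_iff_map_eq_zero]
    intro a ha
    exact X.eq_zero_of_dotProduct fun u => congrFun (congrArg Subtype.val ha) u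
  have hrank : Module.rank ℂ (thetaSpace X.τ X.c n) ≤ n := by
    obtain ⟨k, rfl⟩ := Nat.exists_eq_succ_of_ne_zero hn
    exact rank_thetaSpace_le X.τ_pos X.c_ne_zero k
  have hfin : FiniteDimensional ℂ (thetaSpace X.τ X.c n) :=
    Module.rank_lt_aleph0_iff.mp (hrank.trans_lt (Cardinal.natCast_lt_aleph0))
  have hsurj : Function.Surjective l := by
    have h1 := LinearMap.finrank_le_finrank_of_injective hl
    have h2 : Module.finrank ℂ (thetaSpace X.τ X.c n) ≤ n := Module.finrank_le_of_rank_le hrank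
    rw [Module.finrank_fin_fun] at h1
    exact (LinearMap.injective_iff_surjective_of_finrank_eq_finrank
      ((Module.finrank_fin_fun ℂ).trans (le_antisymm h1 h2))).mp hl
  obtain ⟨a, ha⟩ := hsurj ⟨f, hf⟩
  exact ⟨a, fun u => (congrFun (congrArg Subtype.val ha) u).symm⟩

lemma exists_matrix (hn : n ≠ 0) {G : ℂ → Fin n → ℂ}
    (hG : ∀ j, (fun u => G u j) ∈ thetaSpace X.τ X.c n) :
    ∃ A : Matrix (Fin n) (Fin n) ℂ, ∀ u, G u = A *ᵥ X.F u := by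
  choose A hA using fun j => X.exists_eq_dotProduct hn (hG j)
  exact ⟨Matrix.of A, fun u => funext fun j => hA j u⟩

/-- By completeness the translated coordinates are linear combinations of the old ones. The matrix
is invertible because the translated curve lies in no hyperplane either, and an `n`-th root rescales
its determinant to one. -/
lemma exists_sl_of_translate (hn : n ≠ 0) (t : ℂ) {r : ℂ → ℂ} (hr : ∀ u, r u ≠ 0)
    (hG : ∀ j, (fun u => r u * X.F (u + t) j) ∈ thetaSpace X.τ X.c n) :
    ∃ (a : Matrix.SpecialLinearGroup (Fin n) ℂ) (s : ℂ), s ≠ 0 ∧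
      (∀ u, a.1 *ᵥ X.F u = (s * r u) • X.F (u + t)) ∧
      ∀ P, a • m.toFun P = m.toFun (P + Torus.pt m.L (X.ω * t)) := by
  obtain ⟨A, hA⟩ := X.exists_matrix hn (G := fun u => r u • X.F (u + t)) hG
  have hdet : A.det ≠ 0 := by
    intro h
    obtain ⟨v, hv, hvA⟩ := Matrix.exists_vecMul_eq_zero_iff.mpr h
    obtain ⟨u, hu⟩ := X.exists_dotProduct_ne_zero hv
    have := congrArg (fun w => v ⬝ᵥ w) (hA (u - t))
    rw [Matrix.dotProduct_mulVec, hvA, zero_dotProduct, dotProduct_smul, sub_add_cancel] at this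
    exact (smul_ne_zero (hr _) hu) this
  obtain ⟨s, hs⟩ := IsAlgClosed.exists_pow_nat_eq (A.det)⁻¹ (Nat.pos_of_ne_zero hn)
  have hs0 : s ≠ 0 := by
    rintro rfl
    rw [zero_pow hn] at hs
    exact inv_ne_zero hdet hs.symm
  obtain ⟨a, ha⟩ : ∃ a : Matrix.SpecialLinearGroup (Fin n) ℂ, a.1 = s • A :=
    ⟨⟨s • A, by rw [Matrix.det_smul, Fintype.card_fin, hs, inv_mul_cancel₀ hdet]⟩, rfl⟩
  have haF : ∀ u, a.1 *ᵥ X.F u = (s * r u) • X.F (u + t) := fun u => by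
    rw [ha, Matrix.smul_mulVec, ← hA, smul_smul]
  refine ⟨a, s, hs0, haF, fun P => ?_⟩
  obtain ⟨u, rfl⟩ := X.exists_pt_eq P
  have e : Torus.pt m.L (X.ω * u) + Torus.pt m.L (X.ω * t) = Torus.pt m.L (X.ω * (u + t)) := by
    rw [mul_add]; rfl
  rw [e, X.toFun_pt, X.toFun_pt, Projectivization.smul_mk, Projectivization.mk_eq_mk_iff']
  exact ⟨s * r u, (haF u).symm⟩

/-- Translation by `1/n` preserves the multipliers, while translation by `τ/n` needs the correcting
factor `ex u`. The commutator is the change `ex (1/n)` of this factor under `u ↦ u + 1/n`. -/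
lemma exists_heisenberg_pair (hn : n ≠ 0) : ∃ a b : Matrix.SpecialLinearGroup (Fin n) ℂ,
    (∀ P, a • m.toFun P = m.toFun (P + Torus.pt m.L (X.ω * (1 / n)))) ∧
    (∀ P, b • m.toFun P = m.toFun (P + Torus.pt m.L (X.ω * (X.τ / n)))) ∧
    b.1 * a.1 = ex (1 / n) • (a.1 * b.1) := by
  have hn' : (n : ℂ) ≠ 0 := Nat.cast_ne_zero.mpr hn
  obtain ⟨a, s, hs, ha, ha'⟩ := X.exists_sl_of_translate hn (1 / n) (r := fun _ => 1)
    (fun _ => one_ne_zero) fun j => by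
      obtain ⟨h1, h2, h3⟩ := X.mem_thetaSpace j
      simp only at h2 h3
      refine ⟨(h1.comp (differentiable_id.add_const _)).const_mul _, fun z => ?_, fun z => ?_⟩
      · simp only
        rw [add_right_comm, h2]
      · simp only
        rw [add_right_comm, h3, mul_add, mul_one_div_cancel hn', neg_add, ex_add, ex_neg 1, ex_one]
        ring
  obtain ⟨b, t, ht, hb, hb'⟩ := X.exists_sl_of_translate hn (X.τ / n) (r := ex)
    ex_ne_zero fun j => by
      obtain ⟨h1, h2, h3⟩ := X.mem_thetaSpace j
      simp only at h2 h3
      refine ⟨differentiable_ex.mul (h1.comp (differentiable_id.add_const _)), fun z => ?_,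
        fun z => ?_⟩
      · simp only
        rw [add_right_comm, h2, ex_add, ex_one, mul_one]
      · simp only
        rw [add_right_comm, h3, mul_add, mul_div_cancel₀ _ hn', neg_add, ex_add, ex_add, ex_neg X.τ]
        field_simp [ex_ne_zero]
  refine ⟨a, b, ha', hb', X.matrix_ext fun u => ?_⟩
  rw [← Matrix.mulVec_mulVec, Matrix.smul_mulVec, ← Matrix.mulVec_mulVec, ha, hb,
    Matrix.mulVec_smul, Matrix.mulVec_smul, ha, hb, smul_smul, smul_smul, smul_smul, ex_add,
    add_right_comm]
  congr 1
  ring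

/-- Every `F u` is an eigenvector of `g`, and its eigenvalue varies continuously in a finite set, so
it is constant; the vectors `F u` span. -/
lemma exists_eq_smul_one (X : ThetaLift m) {g : Matrix.SpecialLinearGroup (Fin n) ℂ}
    (hg : ∀ P, g • m.toFun P = m.toFun P) : ∃ t : ℂ, t ^ n = 1 ∧ g.1 = t • 1 := by
  have hex : ∀ u, ∃ t : ℂ, g.1 *ᵥ X.F u = t • X.F u := fun u => by
    have := hg (Torus.pt m.L (X.ω * u))
    rw [X.toFun_pt, Projectivization.smul_mk, Projectivization.mk_eq_mk_iff'] at this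
    obtain ⟨t, ht⟩ := this
    exact ⟨t, ht.symm⟩
  choose t ht using hex
  have hcont : Continuous t := by
    rw [continuous_iff_continuousAt]
    intro u
    obtain ⟨j, hj⟩ := Function.ne_iff.mp (X.F_ne_zero u)
    have hF : ∀ i, Continuous fun u => X.F u i := fun i =>
      (continuous_apply i).comp X.differentiable_F.continuous
    have hgF : Continuous fun u => (g.1 *ᵥ X.F u) j :=
      (continuous_apply j).comp (Continuous.matrix_mulVec continuous_const
        X.differentiable_F.continuous)
    refine ((hgF.continuousAt.div (hF j).continuousAt hj).congr ?_)
    filter_upwards [(hF j).continuousAt.eventually_ne hj] with w hw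
    have := congrFun (ht w) j
    rw [Pi.smul_apply, smul_eq_mul] at this
    exact (div_eq_iff hw).mpr this
  have hfin := Module.End.finite_hasEigenvalue (Matrix.mulVecLin g.1)
  have hconst : ∀ u, t u = t 0 := fun u => by
    refine isPreconnected_univ.constant_of_mapsTo hfin.isDiscrete hcont.continuousOn
      (fun w _ => ?_) (Set.mem_univ u) (Set.mem_univ 0)
    exact Module.End.hasEigenvalue_of_hasEigenvector (x := X.F w)
      ⟨Module.End.mem_eigenspace_iff.mpr (ht w), X.F_ne_zero w⟩
  have e : g.1 = t 0 • 1 := X.matrix_ext fun u => by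
    rw [ht, hconst, Matrix.smul_mulVec, Matrix.one_mulVec]
  refine ⟨t 0, ?_, e⟩
  have := g.2
  rwa [e, Matrix.det_smul, Matrix.det_one, mul_one, Fintype.card_fin] at this

end ThetaLift

/-! ### The invariant form of a genus one normal curve -/

lemma PosHerm.cls_eq_cls_iff {K : Type} [RCLike K] {n : ℕ} {M N : PosHerm K n} :
    M.cls = N.cls ↔ ∃ c : ℝ, 0 < c ∧ N.1 = c • M.1 :=
  Quotient.eq (r := posHermSetoid K n)

lemma posHerm_smul_eq_iff {n : ℕ} {g : Matrix.SpecialLinearGroup (Fin n) ℂ} {M : PosHerm ℂ n} :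
    g • M = M ↔ g.1ᴴ * M.1 * g.1 = M.1 := by
  have v := posHerm_smul_val g⁻¹ M
  rw [inv_inv] at v
  rw [eq_comm, ← inv_smul_eq_iff, ← v]
  exact Subtype.ext_iff

/-- The matrix `g` extends the translation by `T`. -/
def NormalMap.Translates {n : ℕ} (m : NormalMap n) (g : Matrix.SpecialLinearGroup (Fin n) ℂ)
    (T : Torus m.L) : Prop :=
  ∀ P, g • m.toFun P = m.toFun (P + T)

namespace NormalMap

variable {n : ℕ} {m : NormalMap n}

lemma Translates.mul {g h : Matrix.SpecialLinearGroup (Fin n) ℂ} {S T : Torus m.L}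
    (hg : m.Translates g S) (hh : m.Translates h T) : m.Translates (g * h) (S + T) := fun P => by
  rw [mul_smul, hh, hg, add_assoc, add_comm S]

lemma Translates.inv {g : Matrix.SpecialLinearGroup (Fin n) ℂ} {S : Torus m.L}
    (hg : m.Translates g S) : m.Translates g⁻¹ (-S) := fun P => by
  rw [inv_smul_eq_iff, hg, neg_add_cancel_right]

lemma Translates.zpow {g : Matrix.SpecialLinearGroup (Fin n) ℂ} {S : Torus m.L}
    (hg : m.Translates g S) (k : ℤ) : m.Translates (g ^ k) (k • S) := by
  induction k using Int.induction_on with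
  | zero => intro P; simp
  | succ i ih =>
    rw [zpow_add_one, add_smul, one_smul]
    exact ih.mul hg
  | pred i ih =>
    rw [zpow_sub_one, sub_smul, one_smul, sub_eq_add_neg]
    exact ih.mul hg.inv

end NormalMap

/-- The classes of `1/n` and `τ/n` generate the `n`-torsion. -/
lemma ThetaLift.exists_translates {n : ℕ} {m : NormalMap n} (X : ThetaLift m) (hn : n ≠ 0) :
    ∃ (a b : Matrix.SpecialLinearGroup (Fin n) ℂ) (S T : Torus m.L), n • S = 0 ∧ n • T = 0 ∧
      m.Translates a S ∧ m.Translates b T ∧ b.1 * a.1 = ex (1 / n) • (a.1 * b.1) ∧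
      ∀ R : Torus m.L, n • R = 0 → ∃ p q : ℤ, R = p • S + q • T := by
  have hn' : (n : ℂ) ≠ 0 := Nat.cast_ne_zero.mpr hn
  obtain ⟨a, b, ha, hb, hab⟩ := X.exists_heisenberg_pair hn
  have hsmul : ∀ (k : ℤ) (u : ℂ), k • Torus.pt m.L (X.ω * u) = Torus.pt m.L (X.ω * (k * u)) :=
    fun k u => by
      rw [mul_left_comm, ← zsmul_eq_mul]
      rfl
  have hzero : ∀ u, n • Torus.pt m.L (X.ω * u) = 0 ↔ ∃ p q : ℤ, n * u = p + q * X.τ := fun u => by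
    rw [← natCast_zsmul, hsmul, show (0 : Torus m.L) = Torus.pt m.L (X.ω * 0) by
      rw [mul_zero]; rfl, X.pt_eq_iff]
    simp
  refine ⟨a, b, _, _, (hzero _).mpr ⟨1, 0, ?_⟩, (hzero _).mpr ⟨0, 1, ?_⟩, ha, hb, hab, fun R hR => ?_⟩
  · field_simp; simp
  · field_simp; simp
  · obtain ⟨u, rfl⟩ := X.exists_pt_eq R
    obtain ⟨p, q, h⟩ := (hzero u).mp hR
    refine ⟨p, q, ?_⟩
    rw [hsmul, hsmul]
    change _ = Torus.pt m.L (_ + _)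
    rw [← mul_add]
    congr 2
    field_simp
    linear_combination h

lemma NormalMap.exists_translates {n : ℕ} (hn : n ≠ 0) (m : NormalMap n) {R : Torus m.L}
    (hR : n • R = 0) : ∃ g, m.Translates g R := by
  obtain ⟨X⟩ := m.nonempty_thetaLift hn
  obtain ⟨a, b, S, T, -, -, ha, hb, -, h⟩ := X.exists_translates hn
  obtain ⟨p, q, rfl⟩ := h R hR
  exact ⟨_, (ha.zpow p).mul (hb.zpow q)⟩

lemma isPrimitiveRoot_ex {n : ℕ} (hn : n ≠ 0) : IsPrimitiveRoot (ex (1 / n)) n := by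
  have := Complex.isPrimitiveRoot_exp n hn
  rwa [← mul_one_div] at this

/-- An element of the Heisenberg group induces the same translation as some `a ^ p * b ^ q`, hence
differs from it by a scalar root of unity. So invariance only has to be tested on `a` and `b`. -/
theorem NormalMap.exists_invariant {n : ℕ} (hn : n ≠ 0) (m : NormalMap n) :
    ∃ M₀ : PosHerm ℂ n, ∀ M : PosHerm ℂ n, M.cls = M₀.cls ↔ ∀ h ∈ m.heisenberg, h • M = M := by
  obtain ⟨X⟩ := m.nonempty_thetaLift hn
  obtain ⟨a, b, S, T, hS, hT, ha, hb, hab, h⟩ := X.exists_translates hn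
  obtain ⟨⟨M, hM, hMa, hMb⟩, huniq⟩ :=
    exists_unique_invariant_form hn a.2 b.2 (isPrimitiveRoot_ex hn) hab
  have hinv : ∀ N : PosHerm ℂ n, a • N = N → b • N = N → ∀ h ∈ m.heisenberg, h • N = N := by
    rintro N haN hbN g ⟨R, hR, hgR⟩
    obtain ⟨p, q, rfl⟩ := h R hR
    have h1 : m.Translates (g * (a ^ p * b ^ q)⁻¹) _ :=
      NormalMap.Translates.mul hgR ((ha.zpow p).mul (hb.zpow q)).inv
    rw [add_neg_cancel] at h1
    obtain ⟨t, ht, hg⟩ := X.exists_eq_smul_one (g := g * (a ^ p * b ^ q)⁻¹) fun P => by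
      rw [h1, add_zero]
    have hN : (g * (a ^ p * b ^ q)⁻¹) • N = N := by
      rw [posHerm_smul_eq_iff, hg]
      have : star t * t = 1 := by
        rw [Complex.star_def, ← Complex.normSq_eq_conj_mul_self, Complex.normSq_eq_norm_sq,
          Complex.norm_eq_one_of_pow_eq_one ht hn]
        simp
      rw [Matrix.conjTranspose_smul, Matrix.conjTranspose_one, Matrix.smul_mul, Matrix.one_mul,
        Matrix.mul_smul, Matrix.mul_one, smul_smul, mul_comm, this, one_smul]
    have h2 : a ^ p * b ^ q ∈ MulAction.stabilizer (Matrix.SpecialLinearGroup (Fin n) ℂ) N :=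
      mul_mem (zpow_mem (MulAction.mem_stabilizer_iff.mpr haN) p)
        (zpow_mem (MulAction.mem_stabilizer_iff.mpr hbN) q)
    have h3 := mul_mem (MulAction.mem_stabilizer_iff.mpr hN) h2
    rwa [inv_mul_cancel_right] at h3
  refine ⟨⟨M, hM⟩, fun N => ⟨fun hN => ?_, fun hN => ?_⟩⟩
  · obtain ⟨c, hc, e⟩ := PosHerm.cls_eq_cls_iff.mp hN.symm
    refine hinv N ?_ ?_
    · rw [posHerm_smul_eq_iff, e]
      simp only [Matrix.mul_smul, Matrix.smul_mul, hMa]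
    · rw [posHerm_smul_eq_iff, e]
      simp only [Matrix.mul_smul, Matrix.smul_mul, hMb]
  · refine PosHerm.cls_eq_cls_iff.mpr ?_
    exact huniq N.1 M N.2 (posHerm_smul_eq_iff.mp (hN a ⟨S, hS, ha⟩))
      (posHerm_smul_eq_iff.mp (hN b ⟨T, hT, hb⟩)) hM hMa hMb

/-! ### Curves of degree at least three with the same image -/

/-- The lattice is discrete, being the zero set of `theta`. -/
lemma eventually_eq_of_sub_mem_lattice {τ : ℂ} (hτ : 0 < τ.im) {d : ℂ → ℂ} {u : ℂ}
    (hd : ContinuousAt d u) (h : ∀ᶠ w in 𝓝 u, ∃ p q : ℤ, d w = d u + (p + q * τ)) :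
    ∀ᶠ w in 𝓝 u, d w = d u := by
  have h0 : ∀ᶠ w in 𝓝[≠] (0 : ℂ), theta τ w ≠ 0 := by
    rcases ((differentiable_theta hτ).analyticAt 0).eventually_eq_zero_or_eventually_ne_zero with
      h' | h'
    · have := analyticOrderAt_theta hτ 0 0
      rw [Int.cast_zero, zero_mul, add_zero, analyticOrderAt_eq_top.mpr h'] at this
      exact absurd this (by simp)
    · exact h'
  have ht : Filter.Tendsto (fun w => d w - d u) (𝓝 u) (𝓝 0) := by
    simpa using (hd.tendsto.sub_const (d u))
  filter_upwards [h, ht.eventually (eventually_nhdsWithin_iff.mp h0)] with w ⟨p, q, hpq⟩ hw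
  by_contra hne
  refine hw (sub_ne_zero.mpr hne) ?_
  rw [theta_eq_zero_iff hτ]
  exact ⟨p, q, by rw [hpq]; ring⟩

namespace ThetaLift

variable {n : ℕ} {m m' : NormalMap n}

lemma differentiable_F_apply (X : ThetaLift m) (i : Fin n) : Differentiable ℂ fun u => X.F u i :=
  (X.mem_thetaSpace i).1

/-- The parameters `u` and `w` give the same point. -/
def Match (X : ThetaLift m) (X' : ThetaLift m') (u w : ℂ) : Prop :=
  m.toFun (Torus.pt m.L (X.ω * u)) = m'.toFun (Torus.pt m'.L (X'.ω * w))

variable {X : ThetaLift m} {X' : ThetaLift m'}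

lemma match_iff {u w : ℂ} : Match X X' u w ↔ ∀ i j, X.F u i * X'.F w j = X.F u j * X'.F w i := by
  rw [Match, X.toFun_pt, X'.toFun_pt, Projectivization.mk_eq_mk_iff']
  constructor
  · rintro ⟨t, ht⟩ i j
    rw [← ht]
    simp only [Pi.smul_apply, smul_eq_mul]
    ring
  · intro h
    obtain ⟨j, hj⟩ := Function.ne_iff.mp (X'.F_ne_zero w)
    rw [Pi.zero_apply] at hj
    refine ⟨X.F u j / X'.F w j, funext fun i => ?_⟩
    rw [Pi.smul_apply, smul_eq_mul, div_mul_eq_mul_div, div_eq_iff hj]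
    exact (h i j).symm

lemma isClosed_match : IsClosed {x : ℂ × ℂ | Match X X' x.1 x.2} := by
  have e : {x : ℂ × ℂ | Match X X' x.1 x.2}
      = ⋂ i, ⋂ j, {x : ℂ × ℂ | X.F x.1 i * X'.F x.2 j = X.F x.1 j * X'.F x.2 i} := by
    ext x
    simp [match_iff]
  rw [e]
  have hc : ∀ i, Continuous fun u => X.F u i := fun i => (X.differentiable_F_apply i).continuous
  have hc' : ∀ i, Continuous fun u => X'.F u i := fun i => (X'.differentiable_F_apply i).continuous
  refine isClosed_iInter fun i => isClosed_iInter fun j => isClosed_eq ?_ ?_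
  · exact ((hc i).comp continuous_fst).mul ((hc' j).comp continuous_snd)
  · exact ((hc j).comp continuous_fst).mul ((hc' i).comp continuous_snd)

lemma Match.add_left {u w : ℂ} (h : Match X X' u w) (p q : ℤ) :
    Match X X' (u + (p + q * X.τ)) w := by
  rw [Match, X.pt_eq_iff.mpr ⟨p, q, rfl⟩]
  exact h

lemma Match.add_right {u w : ℂ} (h : Match X X' u w) (p q : ℤ) :
    Match X X' u (w + (p + q * X'.τ)) := by
  rw [Match, X'.pt_eq_iff.mpr ⟨p, q, rfl⟩]
  exact h

lemma Match.eq_add (hn : 3 ≤ n) {u w w' : ℂ} (h : Match X X' u w) (h' : Match X X' u w') :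
    ∃ p q : ℤ, w = w' + (p + q * X'.τ) :=
  X'.pt_eq_iff.mp (m'.injective hn (h.symm.trans h'))

lemma exists_match (hr : Set.range m.toFun = Set.range m'.toFun) (u : ℂ) : ∃ w, Match X X' u w := by
  obtain ⟨P, hP⟩ : m.toFun (Torus.pt m.L (X.ω * u)) ∈ Set.range m'.toFun := hr ▸ ⟨_, rfl⟩
  obtain ⟨w, rfl⟩ := X'.exists_pt_eq P
  exact ⟨w, hP.symm⟩

/-- If every such quotient had derivative zero, the derivative of `F` would be proportional to `F`,
against the immersion hypothesis. -/
lemma exists_local_coordinate (X : ThetaLift m) (hn : 3 ≤ n) (w : ℂ) : ∃ i j, X.F w j ≠ 0 ∧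
    AnalyticAt ℂ (fun w => X.F w i / X.F w j) w ∧ deriv (fun w => X.F w i / X.F w j) w ≠ 0 := by
  obtain ⟨j, hj⟩ := Function.ne_iff.mp (X.F_ne_zero w)
  rw [Pi.zero_apply] at hj
  have hω := X.ω_ne_zero
  have hlift : IsLocalLift m.toFun (X.ω * w) (fun z => X.F (z / X.ω)) := by
    refine ⟨(X.differentiable_F.comp (by fun_prop : Differentiable ℂ fun z => z / X.ω)).analyticAt _,
      .of_forall fun z => ⟨X.F_ne_zero _, ?_⟩⟩
    rw [← X.toFun_pt, mul_div_cancel₀ _ hω]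
  have hli := m.immersion hn _ _ hlift
  have hd : ∀ i, HasDerivAt (fun w => X.F w i) (deriv X.F w i) w := fun i =>
    hasDerivAt_pi.mp (X.differentiable_F w).hasDerivAt i
  have hd' : deriv (fun z => X.F (z / X.ω)) (X.ω * w) = X.ω⁻¹ • deriv X.F w := by
    have h1 : HasDerivAt (fun z => z / X.ω) (X.ω⁻¹) (X.ω * w) := by
      simpa using (hasDerivAt_id (X.ω * w)).div_const X.ω
    have h2 : HasDerivAt X.F (deriv X.F w) (X.ω * w / X.ω) := by
      rw [mul_div_cancel_left₀ _ hω]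
      exact (X.differentiable_F w).hasDerivAt
    exact (HasDerivAt.scomp (h := fun z => z / X.ω) (X.ω * w) h2 h1).deriv
  rw [hd', mul_div_cancel_left₀ _ hω, LinearIndependent.pair_iff] at hli
  by_contra! hcon
  have hquot : ∀ i, HasDerivAt (fun w => X.F w i / X.F w j)
      ((deriv X.F w i * X.F w j - X.F w i * deriv X.F w j) / X.F w j ^ 2) w := fun i =>
    (hd i).div (hd j) hj
  have hzero : ∀ i, deriv X.F w i * X.F w j - X.F w i * deriv X.F w j = 0 := fun i => by
    have := hcon i j hj (((X.differentiable_F_apply i).analyticAt w).div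
      ((X.differentiable_F_apply j).analyticAt w) hj)
    rw [(hquot i).deriv, div_eq_zero_iff] at this
    exact this.resolve_right (pow_ne_zero 2 hj)
  have := (hli (-(deriv X.F w j)) (X.F w j * X.ω) (by
    ext i
    simp only [Pi.add_apply, Pi.smul_apply, smul_eq_mul, Pi.zero_apply]
    field_simp
    linear_combination hzero i)).2
  exact mul_ne_zero hj hω this

/-- The holomorphic change of parameter is a local inverse of a coordinate quotient on the second
curve, composed with the same quotient on the first. One quotient does not determine the point, so a
compactness argument must show that the matching parameter lies in the domain of this inverse,
modulo periods. -/
lemma exists_local_match (hn : 3 ≤ n) (hr : Set.range m.toFun = Set.range m'.toFun)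
    (X : ThetaLift m) (X' : ThetaLift m') (u₀ : ℂ) :
    ∃ s : ℂ → ℂ, AnalyticAt ℂ s u₀ ∧ ∀ᶠ u in 𝓝 u₀, Match X X' u (s u) := by
  obtain ⟨w₀, hw₀⟩ := exists_match (X := X) (X' := X') hr u₀
  obtain ⟨i, j, hj, han, hder⟩ := X'.exists_local_coordinate hn w₀
  set v : ℂ → ℂ := fun w => X'.F w i / X'.F w j with hv
  set r : ℂ → ℂ := han.hasStrictDerivAt.localInverse _ _ _ hder with hrdef
  have hra : AnalyticAt ℂ r (v w₀) := han.analyticAt_localInverse hder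
  have hleft : ∀ᶠ w in 𝓝 w₀, r (v w) = w := HasStrictDerivAt.eventually_left_inverse ..
  have hFj : X.F u₀ j ≠ 0 := by
    intro h
    obtain ⟨k, hk⟩ := Function.ne_iff.mp (X.F_ne_zero u₀)
    have := match_iff.mp hw₀ k j
    rw [h, zero_mul] at this
    exact (mul_ne_zero hk hj) this
  have hv₀ : X.F u₀ i / X.F u₀ j = v w₀ := by
    rw [hv, div_eq_div_iff hFj hj]
    rw [match_iff.mp hw₀ i j, mul_comm]
  obtain ⟨U, hU, hUo, hwU⟩ := eventually_nhds_iff.mp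
    (hleft.and ((X'.differentiable_F_apply j).continuous.continuousAt.eventually_ne hj))
  set W : Set ℂ := ⋃ (p : ℤ) (q : ℤ), (fun w => w + (p + q * X'.τ)) ⁻¹' U with hW
  have hWo : IsOpen W := isOpen_iUnion fun p => isOpen_iUnion fun q =>
    hUo.preimage (by fun_prop)
  have hK : IsCompact (parallelogram X'.τ \ W) := (isCompact_parallelogram _).diff hWo
  -- Only translates of `w₀` match `u₀`, and these lie in `W`. Matching is a closed condition, so by
  -- compactness no parameter outside `W` matches a `u` near `u₀`.
  have hfar : ∀ᶠ u in 𝓝 u₀, ∀ w ∈ parallelogram X'.τ \ W, ¬ Match X X' u w := by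
    refine hK.eventually_forall_of_forall_eventually fun w hw => ?_
    refine isClosed_match.isOpen_compl.mem_nhds (x := (u₀, w)) fun h => hw.2 ?_
    obtain ⟨p, q, hpq⟩ := hw₀.eq_add hn h
    exact Set.mem_iUnion₂.mpr ⟨p, q, by rw [Set.mem_preimage, ← hpq]; exact hwU⟩
  refine ⟨fun u => r (X.F u i / X.F u j), ?_, ?_⟩
  · exact hra.comp_of_eq (((X.differentiable_F_apply i).analyticAt u₀).div
      ((X.differentiable_F_apply j).analyticAt u₀) hFj) hv₀
  · filter_upwards [hfar, (X.differentiable_F_apply j).continuous.continuousAt.eventually_ne hFj]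
      with u hu huj
    obtain ⟨w₁, hw₁⟩ := exists_match (X := X) (X' := X') hr u
    obtain ⟨w₂, hw₂, p, q, rfl⟩ := exists_mem_parallelogram X'.τ_pos w₁
    have hm₂ : Match X X' u w₂ := by
      have := hw₁.add_right (-p) (-q)
      convert this using 1
      push_cast
      ring
    have hw₂W : w₂ ∈ W := by
      by_contra h
      exact hu w₂ ⟨hw₂, h⟩ hm₂
    obtain ⟨p', q', hpq⟩ := Set.mem_iUnion₂.mp hw₂W
    rw [Set.mem_preimage] at hpq
    have hm := hm₂.add_right p' q'
    obtain ⟨h1, h2⟩ := hU _ hpq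
    have e : X.F u i / X.F u j = v (w₂ + (p' + q' * X'.τ)) := by
      rw [hv, div_eq_div_iff huj h2]
      rw [match_iff.mp hm i j, mul_comm]
    rw [e, h1]
    exact hm

/-- By injectivity two local matches differ by periods, hence locally by a constant. -/
lemma deriv_eq_of_match (hn : 3 ≤ n) {s t : ℂ → ℂ} {u : ℂ} (hs : AnalyticAt ℂ s u)
    (ht : AnalyticAt ℂ t u) (hsm : ∀ᶠ w in 𝓝 u, Match X X' w (s w))
    (htm : ∀ᶠ w in 𝓝 u, Match X X' w (t w)) : deriv s u = deriv t u := by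
  have h : ∀ᶠ w in 𝓝 u, (s - t) w = (s - t) u := by
    refine eventually_eq_of_sub_mem_lattice X'.τ_pos (hs.sub ht).continuousAt ?_
    obtain ⟨p₀, q₀, h₀⟩ := hsm.self_of_nhds.eq_add hn htm.self_of_nhds
    filter_upwards [hsm, htm] with w h1 h2
    obtain ⟨p, q, h⟩ := h1.eq_add hn h2
    refine ⟨p - p₀, q - q₀, ?_⟩
    rw [Pi.sub_apply, Pi.sub_apply, h, h₀]
    push_cast
    ring
  have h' : deriv (s - t) u = 0 := by
    rw [Filter.EventuallyEq.deriv_eq (f := fun _ => (s - t) u) h, deriv_const]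
  rwa [deriv_sub hs.differentiableAt ht.differentiableAt, sub_eq_zero] at h'

/-- The derivative of a local match does not depend on the choice of match, so it is an entire
doubly periodic function, constant by Liouville's theorem. Local matches are thus affine with a
common slope. -/
lemma exists_affine_match (hn : 3 ≤ n) (hr : Set.range m.toFun = Set.range m'.toFun)
    (X : ThetaLift m) (X' : ThetaLift m') : ∃ α β : ℂ, ∀ u, Match X X' u (α * u + β) := by
  choose s hs hsm using exists_local_match hn hr X X'
  have hnear : ∀ u₀, ∀ᶠ u in 𝓝 u₀, deriv (s u) u = deriv (s u₀) u := fun u₀ => by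
    filter_upwards [(hs u₀).eventually_analyticAt, (hsm u₀).eventually_nhds] with u h1 h2
    exact deriv_eq_of_match hn (hs u) h1 (hsm u) h2
  have hg : Differentiable ℂ fun u => deriv (s u) u := fun u₀ =>
    ((hs u₀).deriv.congr (hnear u₀ |>.mono fun _ h => h.symm)).differentiableAt
  have hper : ∀ (u : ℂ) (p q : ℤ), deriv (s (u + (p + q * X.τ))) (u + (p + q * X.τ))
      = deriv (s u) u := fun u p q => by
    set t : ℂ := p + q * X.τ with ht
    have hsh : AnalyticAt ℂ (fun w : ℂ => w + t) u := by fun_prop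
    have h1 : AnalyticAt ℂ (fun w => s (u + t) (w + t)) u := (hs (u + t)).comp_of_eq hsh rfl
    rw [← deriv_comp_add_const]
    refine deriv_eq_of_match hn h1 (hs u) ?_ (hsm u)
    have : Filter.Tendsto (fun w : ℂ => w + t) (𝓝 u) (𝓝 (u + t)) := hsh.continuousAt
    filter_upwards [this.eventually (hsm (u + t))] with w hw
    have := hw.add_left (-p) (-q)
    convert this using 1
    rw [ht]
    push_cast
    ring
  obtain ⟨C, hC⟩ := exists_bound_of_periodic X.τ_pos hg.continuous.norm
    (fun u => by simpa using congrArg norm (hper u 1 0))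
    (fun u => by simpa using congrArg norm (hper u 0 1))
  have hbd : Bornology.IsBounded (Set.range fun u => deriv (s u) u) := by
    rw [isBounded_iff_forall_norm_le]
    exact ⟨C, by rintro _ ⟨z, rfl⟩; exact (le_abs_self _).trans (hC z)⟩
  obtain ⟨α, hα⟩ := hg.exists_const_forall_eq_of_bounded hbd
  have hloc : ∀ u₀, ∀ᶠ u in 𝓝 u₀, s u₀ u = s u₀ u₀ + α * (u - u₀) := fun u₀ => by
    have h : ∀ᶠ u in 𝓝 u₀, DifferentiableAt ℂ (s u₀) u ∧ deriv (s u₀) u = α := by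
      filter_upwards [(hs u₀).eventually_analyticAt, hnear u₀] with u h1 h2
      exact ⟨h1.differentiableAt, h2.symm.trans (hα u)⟩
    obtain ⟨ε, hε, hball⟩ := Metric.eventually_nhds_iff_ball.mp h
    obtain ⟨a, ha⟩ := Metric.isOpen_ball.exists_is_const_of_deriv_eq_zero
      (convex_ball u₀ ε).isPreconnected (f := fun u => s u₀ u - α * u)
      (fun u hu => ((hball u hu).1.sub (by fun_prop)).differentiableWithinAt)
      (fun u hu => by
        rw [deriv_fun_sub (hball u hu).1 (by fun_prop), (hball u hu).2]
        simp)
    filter_upwards [Metric.ball_mem_nhds u₀ hε] with u hu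
    have h1 := ha u hu
    have h2 := ha u₀ (Metric.mem_ball_self hε)
    linear_combination h1 - h2
  set β := s 0 0 with hβ
  refine ⟨α, β, fun u => ?_⟩
  have hclosed : IsClosed {u | Match X X' u (α * u + β)} :=
    isClosed_match.preimage (f := fun u : ℂ => (u, α * u + β)) (by fun_prop)
  -- Near a parameter where the affine map matches, it differs from the local match by a fixed
  -- period. The matching set is therefore open and closed, and it contains `0` by the choice of
  -- `β`.
  have hopen : IsOpen {u | Match X X' u (α * u + β)} := by
    rw [isOpen_iff_eventually]
    intro u₀ hu₀
    obtain ⟨p, q, hpq⟩ := Match.eq_add hn hu₀ (hsm u₀).self_of_nhds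
    filter_upwards [hsm u₀, hloc u₀] with u h1 h2
    have := h1.add_right p q
    rw [h2] at this
    have e : α * u + β = s u₀ u₀ + α * (u - u₀) + (p + q * X'.τ) := by linear_combination hpq
    change Match X X' u (α * u + β)
    rw [e]
    exact this
  have huniv := IsClopen.eq_univ ⟨hclosed, hopen⟩ ⟨0, by
    have := (hsm 0).self_of_nhds
    change Match X X' 0 (α * 0 + β)
    rwa [mul_zero, zero_add]⟩
  exact Set.eq_univ_iff_forall.mp huniv u

end ThetaLift

/-- Under the affine match, translation by `t` becomes translation by `α * t`. -/
lemma NormalMap.heisenberg_le_of_range_eq {n : ℕ} (hn : 3 ≤ n) {m m' : NormalMap n}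
    (hr : Set.range m.toFun = Set.range m'.toFun) : m.heisenberg ≤ m'.heisenberg := by
  have hn0 : n ≠ 0 := by omega
  obtain ⟨X⟩ := m.nonempty_thetaLift hn0
  obtain ⟨X'⟩ := m'.nonempty_thetaLift hn0
  obtain ⟨α, β, h⟩ := ThetaLift.exists_affine_match hn hr X X'
  rintro g ⟨T, hT, hg⟩
  obtain ⟨t, rfl⟩ := X.exists_pt_eq T
  have hsmul : ∀ {m : NormalMap n} (X : ThetaLift m) (k : ℕ) (u : ℂ),
      k • Torus.pt m.L (X.ω * u) = Torus.pt m.L (X.ω * (k * u)) := fun X k u => by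
    rw [mul_left_comm, ← nsmul_eq_mul]
    rfl
  have hadd : ∀ {m : NormalMap n} (X : ThetaLift m) (u w : ℂ),
      Torus.pt m.L (X.ω * u) + Torus.pt m.L (X.ω * w) = Torus.pt m.L (X.ω * (u + w)) :=
    fun X u w => by rw [mul_add]; rfl
  refine ⟨Torus.pt m'.L (X'.ω * (α * t)), ?_, fun P => ?_⟩
  · have e0 : ∀ {m : NormalMap n} (X : ThetaLift m), (0 : Torus m.L) = Torus.pt m.L (X.ω * 0) :=
      fun X => by rw [mul_zero]; rfl
    rw [hsmul, e0 X, X.pt_eq_iff] at hT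
    obtain ⟨p, q, hpq⟩ := hT
    -- The parameters `0` and `n * t` give the same point, so their images `β` and `α * (n * t) + β`
    -- differ by a period.
    have h1 := (h 0).add_left p q
    have h2 := h (n * t)
    rw [zero_add] at hpq
    rw [zero_add, ← hpq] at h1
    obtain ⟨p', q', e⟩ := h2.eq_add hn h1
    rw [hsmul, e0 X', X'.pt_eq_iff]
    exact ⟨p', q', by linear_combination e⟩
  · obtain ⟨Q, hQ⟩ : m'.toFun P ∈ Set.range m.toFun := hr ▸ ⟨_, rfl⟩
    obtain ⟨u, rfl⟩ := X.exists_pt_eq Q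
    have hP : P = Torus.pt m'.L (X'.ω * (α * u + β)) := m'.injective hn (hQ.symm.trans (h u))
    rw [← hQ, hg, hP, hadd, hadd, show α * u + β + α * t = α * (u + t) + β by ring]
    exact h (u + t)

/-! ### Double covers with the same ramification points -/

/-- Dividing out the zero `p` leaves a space of dimension at most one, and it contains `theta τ (z -
(γ - p))`. -/
lemma exists_eq_mul_theta_mul_theta {τ : ℂ} (hτ : 0 < τ.im) {c : ℂ} (hc : c ≠ 0) {γ : ℂ}
    (hγ : ex γ = c) {f : ℂ → ℂ} (hf : f ∈ thetaSpace τ c 2) {p : ℂ} (hp : f p = 0) :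
    ∃ t : ℂ, ∀ z, f z = t * theta τ (z - p) * theta τ (z - (γ - p)) := by
  obtain ⟨h, hh, e⟩ := exists_eq_theta_mul hτ hc hf hp
  have hc' : -(c * ex (-p)) ≠ 0 := neg_ne_zero.mpr (mul_ne_zero hc (ex_ne_zero _))
  have hθ : (fun z => theta τ (z - (γ - p))) ∈ thetaSpace τ (-(c * ex (-p))) 1 := by
    refine ⟨(differentiable_theta hτ).comp (by fun_prop), fun z => ?_, fun z => ?_⟩
    · simp only
      rw [show z + 1 - (γ - p) = z - (γ - p) + 1 by ring, theta_add_one]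
    · simp only
      rw [show z + τ - (γ - p) = z - (γ - p) + τ by ring, theta_add_tau hτ,
        show -(z - (γ - p)) = γ + -p + -((1 : ℕ) * z) by push_cast; ring, ex_add, ex_add, hγ]
      ring
  obtain ⟨v, hv⟩ := rank_le_one_iff.mp
    ((rank_thetaSpace_le hτ hc' 0).trans (by simp : ((0 + 1 : ℕ) : Cardinal) ≤ 1))
  obtain ⟨r, hr⟩ := hv ⟨h, hh⟩
  obtain ⟨s, hs⟩ := hv ⟨_, hθ⟩
  have hs0 : s ≠ 0 := by
    rintro rfl
    rw [zero_smul] at hs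
    have h0 : ∀ z, theta τ (z - (γ - p)) = 0 := fun z =>
      (congrFun (congrArg Subtype.val hs) z).symm
    have := analyticOrderAt_theta hτ 0 0
    rw [analyticOrderAt_eq_top.mpr (.of_forall fun z => by simpa using h0 (z + (γ - p)))] at this
    simp at this
  refine ⟨r / s, fun z => ?_⟩
  have h1 : r * v.1 z = h z := congrFun (congrArg Subtype.val hr) z
  have h2 : s * v.1 z = theta τ (z - (γ - p)) := congrFun (congrArg Subtype.val hs) z
  rw [e, ← h1, ← h2]
  field_simp

/-- The linear form vanishing at the image of `Q` pulls back to a theta function of weight two,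
whose two zeros have the fixed sum `γ`. -/
lemma exists_fiber_eq (m : NormalMap 2) :
    ∃ G : Torus m.L, ∀ P Q, m.toFun P = m.toFun Q ↔ P = Q ∨ P + Q = G := by
  obtain ⟨X⟩ := m.nonempty_thetaLift two_ne_zero
  obtain ⟨γ, hγ⟩ := exists_ex_eq X.c_ne_zero
  refine ⟨Torus.pt m.L (X.ω * γ), fun P Q => ?_⟩
  obtain ⟨u, rfl⟩ := X.exists_pt_eq P
  obtain ⟨p, rfl⟩ := X.exists_pt_eq Q
  have hadd : Torus.pt m.L (X.ω * u) + Torus.pt m.L (X.ω * p) = Torus.pt m.L (X.ω * (u + p)) := by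
    rw [mul_add]; rfl
  set a : Fin 2 → ℂ := ![X.F p 1, -X.F p 0] with ha
  have hdot : ∀ w, a ⬝ᵥ X.F w = X.F p 1 * X.F w 0 - X.F p 0 * X.F w 1 := fun w => by
    simp [ha, dotProduct, Fin.sum_univ_two]
    ring
  have ha0 : a ≠ 0 := by
    intro h
    apply X.F_ne_zero p
    have h0 := congrFun h 0
    have h1 := congrFun h 1
    simp [ha] at h0 h1
    ext i
    fin_cases i
    · exact h1
    · exact h0
  have hp : a ⬝ᵥ X.F p = 0 := by rw [hdot]; ring
  obtain ⟨t, ht⟩ := exists_eq_mul_theta_mul_theta X.τ_pos X.c_ne_zero hγ (X.dotProduct_mem a) hp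
  have ht0 : t ≠ 0 := by
    rintro rfl
    obtain ⟨w, hw⟩ := X.exists_dotProduct_ne_zero ha0
    exact hw (by rw [ht]; ring)
  have hmatch : m.toFun (Torus.pt m.L (X.ω * u)) = m.toFun (Torus.pt m.L (X.ω * p)) ↔
      a ⬝ᵥ X.F u = 0 := by
    change ThetaLift.Match X X u p ↔ _
    rw [ThetaLift.match_iff, hdot]
    constructor
    · intro h
      linear_combination h 0 1
    · intro h i j
      fin_cases i <;> fin_cases j <;> simp
      · linear_combination h
      · linear_combination -h
  rw [hmatch, ht, mul_assoc, mul_eq_zero_iff_left ht0, mul_eq_zero, theta_eq_zero_iff X.τ_pos,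
    theta_eq_zero_iff X.τ_pos, hadd, X.pt_eq_iff, X.pt_eq_iff]
  refine or_congr (exists₂_congr fun _ _ => ?_) (exists₂_congr fun _ _ => ?_)
  · rw [sub_eq_iff_eq_add']
  · rw [sub_eq_iff_eq_add']
    constructor <;> intro h <;> linear_combination h

lemma exists_two_torsion_basis (L : PeriodPair) : ∃ S T : Torus L, S + S = 0 ∧ T + T = 0 ∧
    S ≠ 0 ∧ T ≠ 0 ∧ S ≠ T ∧ ∀ R, R + R = 0 → R = 0 ∨ R = S ∨ R = T ∨ R = S + T := by
  obtain ⟨ω, τ, hω, hτ, hL⟩ := exists_lattice_normalForm L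
  have hzero : ∀ u, Torus.pt L (ω * u) = 0 ↔ ∃ p q : ℤ, u = p + q * τ := fun u => by
    rw [show (0 : Torus L) = Torus.pt L 0 from rfl, Torus.pt_eq_iff, sub_zero, hL]
    exact exists₂_congr fun p q => mul_right_inj' hω
  have hadd : ∀ u w, Torus.pt L (ω * u) + Torus.pt L (ω * w) = Torus.pt L (ω * (u + w)) :=
    fun u w => by rw [mul_add]; rfl
  have hsub : ∀ u w, Torus.pt L (ω * u) - Torus.pt L (ω * w) = Torus.pt L (ω * (u - w)) :=
    fun u w => by rw [mul_sub]; rfl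
  have hind : ∀ p q : ℤ, (p + q * τ : ℂ) = 0 → p = 0 ∧ q = 0 := fun p q h => by
    have him := congrArg Complex.im h
    simp [hτ.ne'] at him
    rw [him, Int.cast_zero, zero_mul, add_zero] at h
    exact ⟨by exact_mod_cast h, him⟩
  have hhalf : ∀ a b : ℤ, (∃ p q : ℤ, (a / 2 + b * (τ / 2) : ℂ) = p + q * τ) → 2 ∣ a ∧ 2 ∣ b := by
    rintro a b ⟨p, q, h⟩
    have := hind (a - 2 * p) (b - 2 * q) (by push_cast; linear_combination 2 * h)
    exact ⟨⟨p, by omega⟩, ⟨q, by omega⟩⟩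
  refine ⟨Torus.pt L (ω * (1 / 2)), Torus.pt L (ω * (τ / 2)), ?_, ?_, fun h => ?_, fun h => ?_,
    fun h => ?_, fun R hR => ?_⟩
  · rw [hadd, hzero]
    exact ⟨1, 0, by push_cast; ring⟩
  · rw [hadd, hzero]
    exact ⟨0, 1, by push_cast; ring⟩
  · have := hhalf 1 0 (by simpa using (hzero _).mp h)
    omega
  · have := hhalf 0 1 (by simpa using (hzero _).mp h)
    omega
  · rw [← sub_eq_zero, hsub, hzero] at h
    have := hhalf 1 (-1) (by simpa [sub_eq_add_neg] using h)
    omega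
  · obtain ⟨z, rfl⟩ := Submodule.Quotient.mk_surjective _ R
    obtain ⟨u, rfl⟩ : ∃ u, z = ω * u := ⟨z / ω, by rw [mul_div_cancel₀ _ hω]⟩
    change Torus.pt L (ω * u) + Torus.pt L (ω * u) = 0 at hR
    rw [hadd, hzero] at hR
    obtain ⟨p, q, h⟩ := hR
    have hpt : ∀ w, (∃ p q : ℤ, u - w = p + q * τ) → Torus.pt L (ω * u) = Torus.pt L (ω * w) :=
      fun w hw => by rwa [← sub_eq_zero, hsub, hzero]
    change Torus.pt L (ω * u) = 0 ∨ _
    rcases Int.even_or_odd' p with ⟨p', rfl | rfl⟩ <;>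
      rcases Int.even_or_odd' q with ⟨q', rfl | rfl⟩
    · exact Or.inl ((hzero u).mpr ⟨p', q', by push_cast at h; linear_combination h / 2⟩)
    · exact Or.inr (Or.inr (Or.inl (hpt _ ⟨p', q', by push_cast at h; linear_combination h / 2⟩)))
    · exact Or.inr (Or.inl (hpt _ ⟨p', q', by push_cast at h; linear_combination h / 2⟩))
    · refine Or.inr (Or.inr (Or.inr ?_))
      rw [hadd]
      exact hpt _ ⟨p', q', by push_cast at h; linear_combination h / 2⟩

lemma exists_add_self_eq {L : PeriodPair} (P : Torus L) : ∃ Q, Q + Q = P := by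
  obtain ⟨z, rfl⟩ := Submodule.Quotient.mk_surjective _ P
  refine ⟨Torus.pt L (z / 2), ?_⟩
  change Torus.pt L (z / 2 + z / 2) = _
  rw [add_halves]

/-- A fixed nonzero two-torsion point is part of a basis. -/
lemma exists_two_torsion_complement (L : PeriodPair) (T : Torus L) (hT : T + T = 0) :
    ∃ S₁ S₂ : Torus L, S₁ + S₁ = 0 ∧ S₂ + S₂ = 0 ∧ S₁ ≠ 0 ∧ S₂ ≠ 0 ∧ S₁ ≠ S₂ ∧
      (T ≠ 0 → S₁ = T ∧ ∀ R, R + R = 0 → R = 0 ∨ R = T ∨ R = S₂ ∨ R = S₂ + T) := by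
  obtain ⟨A, B, hA, hB, hA0, hB0, hAB, h⟩ := exists_two_torsion_basis L
  have hABA : A + (A + B) = B := by rw [← add_assoc, hA, zero_add]
  by_cases hT0 : T = 0
  · exact ⟨A, B, hA, hB, hA0, hB0, hAB, fun h => absurd hT0 h⟩
  rcases h T hT with rfl | rfl | rfl | rfl
  · exact absurd rfl hT0
  · refine ⟨T, B, hA, hB, hA0, hB0, hAB, fun _ => ⟨rfl, fun R hR => ?_⟩⟩
    rw [add_comm B]
    exact h R hR
  · refine ⟨T, A, hB, hA, hB0, hA0, hAB.symm, fun _ => ⟨rfl, fun R hR => ?_⟩⟩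
    have := h R hR
    tauto
  · refine ⟨A + B, A, hT, hA, hT0, hA0, fun h' => hB0 (add_left_cancel (h'.trans (add_zero A).symm)),
      fun _ => ⟨rfl, fun R hR => ?_⟩⟩
    rw [hABA]
    have := h R hR
    tauto

lemma mk_eq_mk_iff_fin_two {v w : Fin 2 → ℂ} (hv : v ≠ 0) (hw : w ≠ 0) :
    Projectivization.mk ℂ v hv = Projectivization.mk ℂ w hw ↔ v 0 * w 1 - v 1 * w 0 = 0 := by
  rw [Projectivization.mk_eq_mk_iff']
  constructor
  · rintro ⟨t, rfl⟩
    simp only [Pi.smul_apply, smul_eq_mul]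
    ring
  · intro h
    obtain ⟨j, hj⟩ := Function.ne_iff.mp hw
    rw [Pi.zero_apply] at hj
    refine ⟨v j / w j, funext fun i => ?_⟩
    rw [Pi.smul_apply, smul_eq_mul, div_mul_eq_mul_div, div_eq_iff hj]
    fin_cases i <;> fin_cases j <;> simp
    · linear_combination -h
    · linear_combination h

/-- The determinant of `(k v, v)` is a quadratic form in `v` that vanishes exactly at fixed points;
with three zeros on the projective line it vanishes identically. The final linear combination is
Lagrange interpolation. -/
lemma fixes_of_fixes_three {k : Matrix.SpecialLinearGroup (Fin 2) ℂ}
    {x₁ x₂ x₃ : ℙ ℂ (Fin 2 → ℂ)} (h₁₂ : x₁ ≠ x₂) (h₁₃ : x₁ ≠ x₃) (h₂₃ : x₂ ≠ x₃)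
    (h₁ : k • x₁ = x₁) (h₂ : k • x₂ = x₂) (h₃ : k • x₃ = x₃) (y : ℙ ℂ (Fin 2 → ℂ)) : k • y = y := by
  induction x₁ using Projectivization.ind with | h v₁ hv₁ => ?_
  induction x₂ using Projectivization.ind with | h v₂ hv₂ => ?_
  induction x₃ using Projectivization.ind with | h v₃ hv₃ => ?_
  induction y using Projectivization.ind with | h w hw => ?_
  have hk : ∀ (v : Fin 2 → ℂ) (i : Fin 2), (k • v) i = k.1 i 0 * v 0 + k.1 i 1 * v 1 := fun v i =>
    (Fin.sum_univ_two _ : ∑ j, k.1 i j * v j = _)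
  rw [Projectivization.smul_mk, mk_eq_mk_iff_fin_two, hk, hk] at h₁ h₂ h₃ ⊢
  rw [Ne, mk_eq_mk_iff_fin_two] at h₁₂ h₁₃ h₂₃
  refine (mul_eq_zero_iff_right (mul_ne_zero (mul_ne_zero h₁₂ h₁₃) h₂₃)).mp ?_
  linear_combination
    ((w 0 * v₂ 1 - w 1 * v₂ 0) * (w 0 * v₃ 1 - w 1 * v₃ 0) * (v₂ 0 * v₃ 1 - v₂ 1 * v₃ 0)) * h₁
    - ((w 0 * v₁ 1 - w 1 * v₁ 0) * (w 0 * v₃ 1 - w 1 * v₃ 0) * (v₁ 0 * v₃ 1 - v₁ 1 * v₃ 0)) * h₂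
    + ((w 0 * v₁ 1 - w 1 * v₁ 0) * (w 0 * v₂ 1 - w 1 * v₂ 0) * (v₁ 0 * v₂ 1 - v₁ 1 * v₂ 0)) * h₃

/-- Let `P'` and `Q'` be the ramification parameters of `m'` over the images of `P` and `P + T`.
Translation by `T' = Q' - P'` lifts to some `g'`, which agrees with `g` on three common branch
points and so on the whole line. -/
lemma NormalMap.heisenberg_le_of_locus_eq_two {m m' : NormalMap 2} (hl : m.locus = m'.locus) :
    m.heisenberg ≤ m'.heisenberg := by
  obtain ⟨G, hG⟩ := exists_fiber_eq m
  obtain ⟨G', hG'⟩ := exists_fiber_eq m'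
  have hloc : ∀ {m : NormalMap 2} {G : Torus m.L},
      (∀ P Q, m.toFun P = m.toFun Q ↔ P = Q ∨ P + Q = G) →
      ∀ q, q ∈ m.locus ↔ ∃ P, P + P = G ∧ m.toFun P = q := by
    intro m G hG q
    rw [NormalMap.locus, if_pos rfl]
    constructor
    · rintro ⟨P, hP, huniq⟩
      refine ⟨P, ?_, hP⟩
      have : G - P = P := huniq (G - P) (by
        rw [← hP]
        exact (hG _ _).mpr (Or.inr (sub_add_cancel _ _)))
      rw [← eq_sub_iff_add_eq, this]
    · rintro ⟨P, hPG, hP⟩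
      refine ⟨P, hP, fun Q hQ => ?_⟩
      rcases (hG Q P).mp (hQ.trans hP.symm) with h | h
      · exact h
      · exact add_right_cancel (h.trans hPG.symm)
  have hinj : ∀ {m : NormalMap 2} {G : Torus m.L},
      (∀ P Q, m.toFun P = m.toFun Q ↔ P = Q ∨ P + Q = G) →
      ∀ {P Q}, Q + Q = G → m.toFun P = m.toFun Q → P = Q := by
    intro m G hG P Q hQ h
    rcases (hG P Q).mp h with h | h
    · exact h
    · exact add_right_cancel (h.trans hQ.symm)
  obtain ⟨P, hP⟩ := exists_add_self_eq G
  have hPS : ∀ {L : PeriodPair} {P S G : Torus L}, P + P = G → S + S = 0 → P + S + (P + S) = G :=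
    fun hP hS => by rw [add_add_add_comm, hP, hS, add_zero]
  obtain ⟨P', hP', hPP'⟩ := (hloc hG' (m.toFun P)).mp (hl ▸ (hloc hG _).mpr ⟨P, hP, rfl⟩)
  rintro g ⟨T, hT, hg⟩
  rw [two_nsmul] at hT
  obtain ⟨Q', hQ', hQQ'⟩ := (hloc hG' (m.toFun (P + T))).mp
    (hl ▸ (hloc hG _).mpr ⟨P + T, hPS hP hT, rfl⟩)
  set T' := Q' - P' with hT'
  have hT'0 : T' + T' = 0 := by rw [hT', sub_add_sub_comm, hQ', hP', sub_self]
  obtain ⟨g', hg'⟩ := m'.exists_translates two_ne_zero (R := T') (by rw [two_nsmul, hT'0])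
  refine ⟨T', by rw [two_nsmul, hT'0], fun R => ?_⟩
  rw [← hg' R]
  -- If `T ≠ 0`, then `S₁ = T`, and `P`, `P + T`, `P + S₂` parametrize three of the four branch
  -- points.
  obtain ⟨S₁, S₂, hS₁, hS₂, hS₁0, hS₂0, hS₁₂, hS⟩ := exists_two_torsion_complement m.L T hT
  have hQP : Q' = P' + T' := (add_sub_cancel P' Q').symm
  have hPm : ∀ S, S = 0 ∨ S = S₁ ∨ S = S₂ → g' • m.toFun (P + S) = g • m.toFun (P + S) := by
    have hmem : ∀ S, S + S = 0 → ∃ R', R' + R' = G' ∧ m'.toFun R' = m.toFun (P + S) := fun S hS =>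
      (hloc hG' _).mp (hl ▸ (hloc hG _).mpr ⟨P + S, hPS hP hS, rfl⟩)
    by_cases hT0 : T = 0
    · have hT'z : T' = 0 := by
        rw [hT0, add_zero, ← hPP'] at hQQ'
        rw [hT', hinj hG' hP' hQQ', sub_self]
      intro S hS
      have hSS : S + S = 0 := by
        rcases hS with rfl | rfl | rfl
        · exact add_zero 0
        · exact hS₁
        · exact hS₂
      obtain ⟨R', hR', e⟩ := hmem S hSS
      rw [hg, hT0, add_zero, ← e, hg', hT'z, add_zero]
    · obtain ⟨rfl, hST⟩ := hS hT0
      have hT'z : T' ≠ 0 := by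
        intro h
        rw [h, add_zero] at hQP
        rw [hQP, hPP'] at hQQ'
        exact hT0 (left_eq_add.mp (hinj hG (hPS hP hT) hQQ'))
      rintro S (rfl | rfl | rfl)
      · rw [hg, add_zero, ← hPP', hg', ← hQP, hQQ']
      · rw [hg, add_assoc P, hT, add_zero, ← hQQ', hg', hQP, add_assoc, hT'0, add_zero, hPP']
      -- By exclusion: `g'` swaps the images of `P` and `P + T` and, as `T' ≠ 0`, does not fix the
      -- image of `P + S₂`. Hence it sends that point to the fourth branch point, as `g` does.
      · obtain ⟨R', hR', e⟩ := hmem S hS₂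
        rw [hg, ← e, hg']
        obtain ⟨R, hR, e'⟩ := (hloc hG (m'.toFun (R' + T'))).mp
          (hl ▸ (hloc hG' _).mpr ⟨R' + T', hPS hR' hT'0, rfl⟩)
        have hRP : R = P + (R - P) := (add_sub_cancel P R).symm
        rcases hST (R - P) (by rw [sub_add_sub_comm, hR, hP, sub_self]) with h | h | h | h <;>
          rw [hRP, h] at e'
        · rw [add_zero, ← hPP'] at e'
          have h1 := hinj hG' (hPS hR' hT'0) e'
          have h2 : R' = Q' := by rw [hQP, h1, add_assoc, hT'0, add_zero]
          rw [h2, hQQ'] at e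
          exact absurd (add_left_cancel (hinj hG (hPS hP hS₂) e)) hS₁₂
        · rw [← hQQ', hQP] at e'
          have h1 := add_right_cancel (hinj hG' (hPS hR' hT'0) e')
          rw [← h1, hPP'] at e
          exact absurd (left_eq_add.mp (hinj hG (hPS hP hS₂) e)) hS₂0
        · rw [← e] at e'
          exact absurd (left_eq_add.mp (hinj hG' (hPS hR' hT'0) e')) hT'z
        · rw [← e', add_assoc]
  have hfix : ∀ S, S = 0 ∨ S = S₁ ∨ S = S₂ → (g'⁻¹ * g) • m.toFun (P + S) = m.toFun (P + S) :=
    fun S hS => by rw [mul_smul, inv_smul_eq_iff, hPm S hS]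
  have hne : ∀ {S S' : Torus m.L}, S' + S' = 0 → S ≠ S' → m.toFun (P + S) ≠ m.toFun (P + S') :=
    fun hS' h e => h (add_left_cancel (hinj hG (hPS hP hS') e))
  have := fixes_of_fixes_three (hne hS₁ hS₁0.symm) (hne hS₂ hS₂0.symm) (hne hS₂ hS₁₂)
    (hfix 0 (by simp)) (hfix S₁ (by simp)) (hfix S₂ (by simp)) (m'.toFun R)
  rwa [mul_smul, inv_smul_eq_iff] at this

/-! ### The covariant map -/

variable {n : ℕ}

lemma NormalMap.heisenberg_eq_of_locus_eq (hn : 2 ≤ n) {m m' : NormalMap n}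
    (h : m.locus = m'.locus) : m.heisenberg = m'.heisenberg := by
  rcases hn.eq_or_lt with rfl | hn
  · exact le_antisymm (heisenberg_le_of_locus_eq_two h) (heisenberg_le_of_locus_eq_two h.symm)
  · have hr : Set.range m.toFun = Set.range m'.toFun := by
      simpa only [NormalMap.locus, if_neg hn.ne'] using h
    exact le_antisymm (heisenberg_le_of_range_eq hn hr) (heisenberg_le_of_range_eq hn hr.symm)

lemma NormalMap.smul_locus_of_mem_heisenberg {m : NormalMap n}
    {h : Matrix.SpecialLinearGroup (Fin n) ℂ} (hh : h ∈ m.heisenberg) : h • m.locus = m.locus := by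
  obtain ⟨T, -, hT⟩ := hh
  rw [← m.locus_smul]
  have e : ∀ q (P : Torus m.L), (m.smul h).toFun P = q ↔ m.toFun (P + T) = q := fun q P => by
    rw [← hT P]
    rfl
  unfold NormalMap.locus
  split_ifs
  · ext q
    exact (existsUnique_congr (e q)).trans ((Equiv.addRight T).existsUnique_congr fun _ => Iff.rfl)
  · ext q
    exact (exists_congr (e q)).trans ((Equiv.addRight T).exists_congr fun _ => Iff.rfl)

lemma NormalMap.conj_mem_heisenberg {m : NormalMap n} {g h : Matrix.SpecialLinearGroup (Fin n) ℂ}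
    (hh : h ∈ (m.smul g).heisenberg) : g⁻¹ * h * g ∈ m.heisenberg := by
  obtain ⟨T, hT, hP⟩ := hh
  refine ⟨T, hT, fun P => ?_⟩
  rw [mul_smul, mul_smul, inv_smul_eq_iff]
  exact hP P

lemma exists_heisenberg_class (hn : 2 ≤ n) (C : NormalCurve n) : ∃ x : HermClass ℂ n,
    ∀ m : NormalMap n, m.locus = C.1 → ∀ M : PosHerm ℂ n,
      M.cls = x ↔ ∀ h ∈ m.heisenberg, h • M = M := by
  obtain ⟨m₀, hm₀⟩ := C.2
  obtain ⟨M₀, hM₀⟩ := m₀.exists_invariant (by omega)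
  refine ⟨M₀.cls, fun m hm => ?_⟩
  rw [NormalMap.heisenberg_eq_of_locus_eq hn (hm.trans hm₀.symm)]
  exact hM₀

lemma HermClass.exists_eq_cls {K : Type} [RCLike K] (x : HermClass K n) :
    ∃ M : PosHerm K n, M.cls = x :=
  Quotient.exists_rep x

lemma cls_smul {K : Type} [RCLike K] (g : Matrix.SpecialLinearGroup (Fin n) K) (M : PosHerm K n) :
    (g • M).cls = g • M.cls := rfl

/-- The action preserves determinants, so the positive factor satisfies `c ^ n = 1` and equals one.
-/
lemma smul_eq_of_cls_eq (hn : n ≠ 0) {g : Matrix.SpecialLinearGroup (Fin n) ℂ} {M : PosHerm ℂ n}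
    (h : g • M.cls = M.cls) : g • M = M := by
  rw [← cls_smul] at h
  obtain ⟨c, hc, e⟩ := PosHerm.cls_eq_cls_iff.mp h.symm
  have e' : (g • M).1 = (c : ℂ) • M.1 := by
    rw [e]
    ext i j
    simp
  have hdet : (g • M).1.det = M.1.det := by
    rw [posHerm_smul_val, Matrix.det_mul, Matrix.det_mul, Matrix.det_conjTranspose, (g⁻¹).2]
    simp
  rw [e', Matrix.det_smul, Fintype.card_fin] at hdet
  have hc1 : (c : ℂ) ^ n = 1 := mul_right_cancel₀ M.2.det_pos.ne' (hdet.trans (one_mul _).symm)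
  have hc2 : c ^ n = 1 := by exact_mod_cast hc1
  rw [pow_eq_one_iff_of_nonneg hc.le hn] at hc2
  apply Subtype.ext
  rw [e, hc2, one_smul]

/-- A Heisenberg element `h` maps the curve to itself, so covariance makes it fix the class `φ C`,
and by `smul_eq_of_cls_eq` every representative. Only one class is invariant. -/
lemma cls_eq_iff_of_isCovariant (hn : 2 ≤ n) {φ : NormalCurve n → HermClass ℂ n}
    (hφ : IsCovariant φ) (C : NormalCurve n) (m : NormalMap n) (hm : m.locus = C.1)
    (M : PosHerm ℂ n) : M.cls = φ C ↔ ∀ h ∈ m.heisenberg, h • M = M := by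
  obtain ⟨x, hx⟩ := exists_heisenberg_class hn C
  suffices φ C = x by rw [this]; exact hx m hm M
  obtain ⟨N, hN⟩ := (φ C).exists_eq_cls
  rw [← hN, hx m hm]
  intro h hh
  have hC : h • C = C := Subtype.ext (by
    change h • C.1 = C.1
    rw [← hm, NormalMap.smul_locus_of_mem_heisenberg hh])
  apply smul_eq_of_cls_eq (by omega)
  rw [hN, ← hφ, hC]

theorem existsUnique_isCovariant (hn : 2 ≤ n) :
    ∃! φ : NormalCurve n → HermClass ℂ n, IsCovariant φ := by
  choose φ hφ using exists_heisenberg_class hn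
  have hcov : IsCovariant φ := fun g C => by
    obtain ⟨m, hm⟩ := C.2
    obtain ⟨M, hM⟩ := (φ C).exists_eq_cls
    have hg : (m.smul g).locus = (g • C).1 := by rw [m.locus_smul, hm]; rfl
    rw [← hM, ← cls_smul, eq_comm, hφ (g • C) _ hg]
    intro h hh
    -- The Heisenberg group of `g • C` is the conjugate by `g` of that of `C`.
    have := (hφ C m hm M).mp hM _ (NormalMap.conj_mem_heisenberg hh)
    rwa [mul_smul, mul_smul, inv_smul_eq_iff] at this
  refine ⟨φ, hcov, fun ψ hψ => funext fun C => ?_⟩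
  obtain ⟨m, hm⟩ := C.2
  obtain ⟨M, hM⟩ := (φ C).exists_eq_cls
  rw [← hM, eq_comm, cls_eq_iff_of_isCovariant hn hψ C m hm, ← hφ C m hm, hM]

/-! ### Complex conjugation -/

/-- The complex conjugate matrix. -/
def conjSL (g : Matrix.SpecialLinearGroup (Fin n) ℂ) : Matrix.SpecialLinearGroup (Fin n) ℂ :=
  Matrix.SpecialLinearGroup.map (starRingEnd ℂ) g

lemma conjSL_conjSL (g : Matrix.SpecialLinearGroup (Fin n) ℂ) : conjSL (conjSL g) = g := by
  apply Subtype.ext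
  ext i j
  simp [conjSL]

lemma conjSL_inv (g : Matrix.SpecialLinearGroup (Fin n) ℂ) : (conjSL g)⁻¹ = conjSL g⁻¹ :=
  (map_inv (Matrix.SpecialLinearGroup.map (starRingEnd ℂ)) g).symm

lemma conjProj_smul (g : Matrix.SpecialLinearGroup (Fin n) ℂ) (x : ℙ ℂ (Fin n → ℂ)) :
    conjProj n (g • x) = conjSL g • conjProj n x := by
  induction x using Projectivization.ind with | h v hv => ?_
  rw [conjProj_mk, Projectivization.smul_mk, Projectivization.smul_mk, conjProj_mk]
  congr 1
  ext i
  change star (∑ j, g.1 i j * v j) = ∑ j, conj (g.1 i j) * star (v j)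
  simp

lemma NormalCurve.conj_smul (g : Matrix.SpecialLinearGroup (Fin n) ℂ) (C : NormalCurve n) :
    (g • C).conj = conjSL g • C.conj := by
  apply Subtype.ext
  change conjProj n '' (g • C.1) = conjSL g • (conjProj n '' C.1)
  simp only [← Set.image_smul, Set.image_image, conjProj_smul]

lemma NormalCurve.conj_conj (C : NormalCurve n) : C.conj.conj = C := by
  apply Subtype.ext
  change conjProj n '' (conjProj n '' C.1) = C.1
  simp only [Set.image_image, conjProj_conjProj, Set.image_id']

lemma HermClass.conj_smul (g : Matrix.SpecialLinearGroup (Fin n) ℂ) (x : HermClass ℂ n) :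
    (g • x).conj = conjSL g • x.conj := by
  obtain ⟨M, rfl⟩ := x.exists_eq_cls
  refine congrArg PosHerm.cls (Subtype.ext ?_)
  change ((g⁻¹).1ᴴ * M.1 * (g⁻¹).1).map (starRingEnd ℂ)
    = ((conjSL g)⁻¹).1ᴴ * M.1.map (starRingEnd ℂ) * ((conjSL g)⁻¹).1
  rw [Matrix.map_mul, Matrix.map_mul, conjSL_inv]
  rfl

/-- The map `C ↦ conj (φ (conj C))` is covariant too, so it is `φ` by uniqueness. -/
theorem map_conj_of_isCovariant (hn : 2 ≤ n) {φ : NormalCurve n → HermClass ℂ n}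
    (hφ : IsCovariant φ) (C : NormalCurve n) : φ C.conj = (φ C).conj := by
  have h : IsCovariant fun C => (φ C.conj).conj := fun g C => by
    simp only
    rw [NormalCurve.conj_smul, hφ, HermClass.conj_smul, conjSL_conjSL]
  have := congrFun ((existsUnique_isCovariant hn).unique hφ h) C.conj
  rwa [NormalCurve.conj_conj] at this

/-! ### Real curves -/

lemma aeval_star (p : MvPolynomial (Fin n) ℝ) (v : Fin n → ℂ) :
    MvPolynomial.aeval (star v) p = star (MvPolynomial.aeval v p) := by
  rw [MvPolynomial.aeval_def, MvPolynomial.aeval_def, MvPolynomial.eval₂_eq',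
    MvPolynomial.eval₂_eq', star_sum]
  refine Finset.sum_congr rfl fun d _ => ?_
  simp

lemma conjProj_mem_zeroLocus {S : Set (MvPolynomial (Fin n) ℝ)}
    (hS : ∀ p ∈ S, ∃ d, p.IsHomogeneous d) {x : ℙ ℂ (Fin n → ℂ)} (hx : x ∈ zeroLocus S) :
    conjProj n x ∈ zeroLocus S := by
  intro p hp
  obtain ⟨d, hd⟩ := hS p hp
  have := hx p hp
  induction x using Projectivization.ind with | h v hv => ?_
  rw [aeval_rep_eq_zero_iff hd] at this
  rw [conjProj_mk, aeval_rep_eq_zero_iff hd, aeval_star, this, star_zero]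

/-- Zero sets of real homogeneous polynomials are stable under conjugation. -/
lemma NormalCurve.IsReal.conj_eq {C : NormalCurve n} (hC : C.IsReal) : C.conj = C := by
  obtain ⟨S, hS, e⟩ := hC
  apply Subtype.ext
  change conjProj n '' C.1 = C.1
  rw [e]
  refine Set.Subset.antisymm ?_ fun x hx => ?_
  · rintro _ ⟨x, hx, rfl⟩
    exact conjProj_mem_zeroLocus hS hx
  · exact ⟨_, conjProj_mem_zeroLocus hS hx, conjProj_conjProj x⟩

lemma posDef_of_map_ofReal {N : Matrix (Fin n) (Fin n) ℝ}
    (h : (N.map (algebraMap ℝ ℂ)).PosDef) : N.PosDef := by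
  apply Matrix.PosDef.of_dotProduct_mulVec_pos
  · ext i j
    have := congrFun (congrFun h.isHermitian i) j
    simpa using this
  · intro x hx
    have hx' : (fun i => (x i : ℂ)) ≠ 0 := fun h0 => hx (funext fun i => by
      have : (x i : ℂ) = 0 := congrFun h0 i
      exact_mod_cast this)
    have := h.dotProduct_mulVec_pos hx'
    have e : star (fun i => (x i : ℂ)) ⬝ᵥ (N.map (algebraMap ℝ ℂ) *ᵥ fun i => (x i : ℂ))
        = ((star x ⬝ᵥ (N *ᵥ x) : ℝ) : ℂ) := by
      simp [dotProduct, Matrix.mulVec]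
    rw [e] at this
    exact_mod_cast this

/-- Invariance gives `M = c • conj M`. A diagonal entry is real and positive, so `c = 1` and all
entries are real. -/
lemma HermClass.exists_ofReal_eq (hn : n ≠ 0) {x : HermClass ℂ n} (hx : x.conj = x) :
    ∃ y : HermClass ℝ n, y.ofReal = x := by
  obtain ⟨M, rfl⟩ := x.exists_eq_cls
  obtain ⟨c, hc, e⟩ := PosHerm.cls_eq_cls_iff.mp hx
  have hconj : ∀ i j, M.1 i j = c • conj (M.1 i j) := fun i j => congrFun (congrFun e i) j
  have hc1 : c = 1 := by
    let i : Fin n := ⟨0, Nat.pos_of_ne_zero hn⟩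
    have hpos : 0 < M.1 i i := M.2.diag_pos
    have hself : conj (M.1 i i) = M.1 i i := congrFun (congrFun M.2.isHermitian i) i
    have := hconj i i
    rw [hself, Complex.real_smul] at this
    have hc' : (1 : ℂ) = c := mul_right_cancel₀ hpos.ne' ((one_mul _).trans this)
    exact_mod_cast hc'.symm
  have hre : (M.1.map Complex.re).map (algebraMap ℝ ℂ) = M.1 := by
    ext i j
    have := hconj i j
    rw [hc1, one_smul, eq_comm, Complex.conj_eq_iff_re] at this
    exact this
  have hpd : (M.1.map Complex.re).PosDef := posDef_of_map_ofReal (by rw [hre]; exact M.2)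
  exact ⟨PosHerm.cls ⟨_, hpd⟩, congrArg PosHerm.cls (Subtype.ext hre)⟩

lemma HermClass.ofReal_injective : Function.Injective (HermClass.ofReal (n := n)) := by
  intro x y h
  obtain ⟨M, rfl⟩ := x.exists_eq_cls
  obtain ⟨N, rfl⟩ := y.exists_eq_cls
  obtain ⟨c, hc, e⟩ := PosHerm.cls_eq_cls_iff.mp h
  refine PosHerm.cls_eq_cls_iff.mpr ⟨c, hc, ?_⟩
  ext i j
  have : ((N.1 i j : ℝ) : ℂ) = c • ((M.1 i j : ℝ) : ℂ) := congrFun (congrFun e i) j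
  rw [Complex.real_smul] at this
  exact_mod_cast this

lemma HermClass.ofReal_smul (g : Matrix.SpecialLinearGroup (Fin n) ℝ) (x : HermClass ℝ n) :
    (g • x).ofReal = slOfReal g • x.ofReal := by
  obtain ⟨M, rfl⟩ := x.exists_eq_cls
  refine congrArg PosHerm.cls (Subtype.ext ?_)
  have e : (slOfReal g)⁻¹ = slOfReal g⁻¹ :=
    (map_inv (Matrix.SpecialLinearGroup.map (algebraMap ℝ ℂ)) g).symm
  change ((g⁻¹).1ᴴ * M.1 * (g⁻¹).1).map (algebraMap ℝ ℂ)
    = ((slOfReal g)⁻¹).1ᴴ * M.1.map (algebraMap ℝ ℂ) * ((slOfReal g)⁻¹).1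
  rw [Matrix.map_mul, Matrix.map_mul, e]
  congr 2
  ext i j
  change (((g⁻¹).1 j i : ℝ) : ℂ) = conj (((g⁻¹).1 j i : ℝ) : ℂ)
  rw [Complex.conj_ofReal]

end GenusOne

end

/-! ### The main theorem -/

theorem mainTheorem11 (n : ℕ) (hn : 2 ≤ n) :
    -- there is a unique covariant map
    (∃! φ : GenusOne.NormalCurve n → GenusOne.HermClass ℂ n, GenusOne.IsCovariant φ) ∧
    ∀ φ : GenusOne.NormalCurve n → GenusOne.HermClass ℂ n, GenusOne.IsCovariant φ →
      -- its value is the class of the Heisenberg-invariant inner product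
      (∀ (C : GenusOne.NormalCurve n) (m : GenusOne.NormalMap n), m.locus = C.1 →
        ∀ M : GenusOne.PosHerm ℂ n, M.cls = φ C ↔ ∀ h ∈ m.heisenberg, h • M = M) ∧
      -- it is compatible with complex conjugation
      (∀ C : GenusOne.NormalCurve n, φ C.conj = (φ C).conj) ∧
      -- it restricts to a covariant map on real curves
      ∃ φR : GenusOne.RealNormalCurve n → GenusOne.HermClass ℝ n,
        (∀ C : GenusOne.RealNormalCurve n, (φR C).ofReal = φ C.1) ∧
        ∀ (g : Matrix.SpecialLinearGroup (Fin n) ℝ) (C : GenusOne.RealNormalCurve n),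
          φR (g • C) = g • φR C := by
  refine ⟨GenusOne.existsUnique_isCovariant hn, fun φ hφ =>
    ⟨GenusOne.cls_eq_iff_of_isCovariant hn hφ, GenusOne.map_conj_of_isCovariant hn hφ, ?_⟩⟩
  have hreal : ∀ C : GenusOne.RealNormalCurve n, ∃ y : GenusOne.HermClass ℝ n,
      y.ofReal = φ C.1 := fun C =>
    GenusOne.HermClass.exists_ofReal_eq (by omega)
      (by rw [← GenusOne.map_conj_of_isCovariant hn hφ, C.2.conj_eq])
  choose φR hφR using hreal
  -- Classes of real forms embed in classes of Hermitian forms, so real covariance can be checked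
  -- after the embedding.
  refine ⟨φR, hφR, fun g C => GenusOne.HermClass.ofReal_injective ?_⟩
  rw [hφR, GenusOne.HermClass.ofReal_smul, hφR]
  exact hφ (GenusOne.slOfReal g) C.1
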